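/- Let $m\in\{2,3\}$, let $\mathcal G=(\mathcal V,\mathcal E)$ be a graph on $n$ vertices, and let $q^*=(q_1^*,\dots,q_n^*)$, $q_i^*\in\mathbb R^m$, be a target formation with edge lengths $d_{ij}=\|q_i^*-q_j^*\|$, $(i,j)\in\mathcal E$. For $p\in\mathbb R^{mn}$ let $R(p)\in\mathbb R^{|\mathcal E|\times mn}$ be the rigidity matrix, $R(p)=\tfrac12\,\partial\Phi/\partial p$ with $\Phi(p)=(\|p_i-p_j\|^2)_{(i,j)\in\mathcal E}$; $(\mathcal G,p)$ is infinitesimally rigid if $\operatorname{rank}R(p)=mn-\frac{m(m+1)}2$. Assume that $(\mathcal G,q^*)$ is minimally and infinitesimally rigid, i.e. infinitesimally rigid with $|\mathcal E|=mn-\frac{m(m+1)}2$, and that every framework $(\mathcal G,p)$ with the same edge lengths as $(\mathcal G,q^*)$ that is not congruent to it is infinitesimally rigid. Then there is a constant $\bar\vartheta>0$, depending only on $(\mathcal G,q^*)$, such that the following holds. Let agent $i$ have geometric radius $r_{si}>0$ and sensing radius $r_{ci}>r_{si}$. For $(i,j)\in\mathcal E$ put $r_{sij}=r_{si}+r_{sj}$,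 and let $r_{cij}$ be either $\min\{r_{ci},r_{cj}\}$ for all edges, or $\min\{r_{ci}+r_{sj},\,r_{cj}+r_{si}\}$ for all edges. Assume $r_{sij}<d_{ij}<r_{cij}$ on every edge. Let $q^0$ be an initial configuration with $r_{sij}<\|q^0_i-q^0_j\|<r_{cij}$ for all $(i,j)\in\mathcal E$, and put $e_{ij}(0)=\|q_i^0-q_j^0\|-d_{ij}$. Choose $\mu>0$, $0<\overline\mu_{ij}\le r_{cij}-d_{ij}$, $0<\underline\mu_{ij}\le d_{ij}-r_{sij}$, and set $$\overline e_{ij}(0)=\min\{|e_{ij}(0)|+\mu,\ r_{cij}-d_{ij}\},\quad \underline e_{ij}(0)=\min\{|e_{ij}(0)|+\mu,\ \underline\mu_{ij}\}\qquad\text{if } e_{ij}(0)\ge0,$$ $$\overline e_{ij}(0)=\min\{|e_{ij}(0)|+\mu,\ \overline\mu_{ij}\},\quad \underline e_{ij}(0)=\min\{|e_{ij}(0)|+\mu,\ d_{ij}-r_{sij}\}\qquad\text{if } e_{ij}(0)<0.$$ Assume $e(0)\in\Omega_I$, i.e. $\sum_{(i,j)\in\mathcal E}\max\{|\underline e_{ij}(0)|,|\overline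 e_{ij}(0)|\}\le\bar\vartheta$. Let $\rho_{ij}(t)=(\rho_{ij0}-\rho_{ij\infty})e^{-a_{ij}t}+\rho_{ij\infty}$ with $\rho_{ij0}>\rho_{ij\infty}>0$, $a_{ij}>0$, and define $\overline b_{ij},\underline b_{ij}$ by $\overline b_{ij}\rho_{ij0}=\overline e_{ij}(0)^2+2d_{ij}\overline e_{ij}(0)$ and $\underline b_{ij}\rho_{ij0}=2d_{ij}\underline e_{ij}(0)-\underline e_{ij}(0)^2$. Put $\eta_{ij}=\|q_i-q_j\|^2-d_{ij}^2$, $\hat\eta_{ij}=\eta_{ij}/\rho_{ij}$, $$\sigma_{ij}=\tfrac12\ln\frac{\overline b_{ij}\hat\eta_{ij}+\overline b_{ij}\underline b_{ij}}{\overline b_{ij}\underline b_{ij}-\underline b_{ij}\hat\eta_{ij}},\qquad \xi_{ij}=\frac1{\rho_{ij}}\Big[\frac1{\hat\eta_{ij}+\underline b_{ij}}-\frac1{\hat\eta_{ij}-\overline b_{ij}}\Big],$$ and $\sigma=\operatorname{col}(\sigma_{ij})$, $\xi=\operatorname{diag}(\xi_{ij})$, $K=\operatorname{diag}(k_{ij})$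 with $k_{ij}>0$. Let $\delta_1,\dots,\delta_n:[0,\infty)\to\mathbb R^m$ be bounded and piecewise continuous. Then the closed-loop system $\dot q_i=u_i+\delta_i(t)$, $q(0)=q^0$, with the control law $u=-R(q)^T\xi K\sigma$, has a solution $q$ on $[0,\infty)$ (understood as a continuous solution of the integral equation), and every solution on an interval $[0,T)$ coincides with it there. Moreover, for all $t\ge0$ and $(i,j)\in\mathcal E$: (i) $-\underline b_{ij}\rho_{ij}(t)<\eta_{ij}(t)<\overline b_{ij}\rho_{ij}(t)$; (ii) $\|q_i(t)-q_j(t)\|<r_{cij}$ (connectivity maintenance); (iii) $\|q_i(t)-q_j(t)\|>r_{sij}$ (collision avoidance); (iv) $(\mathcal G,q(t))$ is infinitesimally rigid, in particular at $t=0$; and (v) the signals $\|q_i-q_j\|$, $e_{ij}=\|q_i-q_j\|-d_{ij}$, $\eta_{ij}$, $\hat\eta_{ij}$, $\sigma_{ij}$, $\xi_{ij}$ for $(i,j)\in\mathcal E$ and the inputs $u_i$ of all agents are bounded on $[0,\infty)$. -/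

import Mathlib

open Set Filter Topology MeasureTheory

noncomputable section

namespace Formation

/-! ### Frameworks and rigidity -/

/-- Realizations of `n` points in `ℝ^m`. -/
abbrev Config (n m : ℕ) : Type := Fin n → EuclideanSpace ℝ (Fin m)

/-- First endpoint of an edge (edges are oriented from the smaller to the larger vertex). -/
def edgeFst {n : ℕ} {G : SimpleGraph (Fin n)} (e : G.edgeSet) : Fin n :=
  (e : Sym2 (Fin n)).inf

/-- Second endpoint of an edge. -/
def edgeSnd {n : ℕ} {G : SimpleGraph (Fin n)} (e : G.edgeSet) : Fin n :=
  (e : Sym2 (Fin n)).sup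

/-- The relative position `p_i - p_j` along an edge. -/
def edgeVec {n m : ℕ} {G : SimpleGraph (Fin n)} (p : Config n m) (e : G.edgeSet) :
    EuclideanSpace ℝ (Fin m) :=
  p (edgeFst e) - p (edgeSnd e)

/-- The length `‖p_i - p_j‖` of an edge. -/
def edgeLen {n m : ℕ} {G : SimpleGraph (Fin n)} (p : Config n m) (e : G.edgeSet) : ℝ :=
  ‖edgeVec p e‖

/-- The rigidity matrix: the row of the edge `(i, j)` has the block `p_i - p_j` at vertex `i`,
the block `-(p_i - p_j)` at vertex `j`, and zeros elsewhere. -/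
def rigidityMatrix {n m : ℕ} (G : SimpleGraph (Fin n)) (p : Config n m) :
    Matrix G.edgeSet (Fin n × Fin m) ℝ :=
  Matrix.of fun e v =>
    if v.1 = edgeFst e then edgeVec p e v.2
    else if v.1 = edgeSnd e then -(edgeVec p e v.2)
    else 0

/-- Infinitesimal rigidity: `rank R(p) = m n - m (m + 1) / 2`
(written without subtraction; `m (m + 1)` is even). -/
def InfRigid {n m : ℕ} (G : SimpleGraph (Fin n)) (p : Config n m) : Prop :=
  (rigidityMatrix G p).rank + m * (m + 1) / 2 = m * n

/-- Minimal and infinitesimal rigidity: infinitesimally rigid with exactly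
`m n - m (m + 1) / 2` edges (`2 n - 3` in the plane, `3 n - 6` in space). -/
def MinInfRigid {n m : ℕ} (G : SimpleGraph (Fin n)) [Fintype G.edgeSet]
    (p : Config n m) : Prop :=
  InfRigid G p ∧ Fintype.card G.edgeSet + m * (m + 1) / 2 = m * n

/-- Two frameworks on `G` are equivalent if corresponding edges have the same length. -/
def Equivalent {n m : ℕ} (G : SimpleGraph (Fin n)) (p q : Config n m) : Prop :=
  ∀ e : G.edgeSet, edgeLen p e = edgeLen q e

/-- Two frameworks are congruent if all pairs of vertices have the same distance. -/
def Congruent {n m : ℕ} (p q : Config n m) : Prop :=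
  ∀ i j : Fin n, ‖p i - p j‖ = ‖q i - q j‖

/-- Every framework that is equivalent but not congruent to `(G, p)` is infinitesimally rigid. -/
def AmbiguitiesInfRigid {n m : ℕ} (G : SimpleGraph (Fin n)) (p : Config n m) : Prop :=
  ∀ q : Config n m, Equivalent G q p → ¬ Congruent q p → InfRigid G q

/-! ### Problem data -/

/-- The constants of the problem and of the controller. -/
structure Params {n : ℕ} (G : SimpleGraph (Fin n)) where
  /-- geometric radius `r_{si}` of an agent -/
  rs : Fin n → ℝ
  /-- sensing radius `r_{ci}` of an agent -/
  rc : Fin n → ℝ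
  /-- common sensing range `r_{cij}` of two neighbours -/
  rcE : G.edgeSet → ℝ
  /-- the margin `μ` -/
  mu : ℝ
  /-- upper formation robustness constants -/
  muUp : G.edgeSet → ℝ
  /-- lower formation robustness constants -/
  muLo : G.edgeSet → ℝ
  /-- initial values of the performance functions -/
  rho0 : G.edgeSet → ℝ
  /-- limits of the performance functions -/
  rhoInf : G.edgeSet → ℝ
  /-- decay rates of the performance functions -/
  a : G.edgeSet → ℝ
  /-- control gains -/
  k : G.edgeSet → ℝ

variable {n m : ℕ} {G : SimpleGraph (Fin n)}

/-- The safety distance `r_{sij} = r_{si} + r_{sj}` of two neighbours. -/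
def Params.rsE (P : Params G) (e : G.edgeSet) : ℝ := P.rs (edgeFst e) + P.rs (edgeSnd e)

/-- The conditions on the constants, for the target realization `qs`. The common sensing range is
either `min {r_{ci}, r_{cj}}` on every edge, or `min {r_{ci} + r_{sj}, r_{cj} + r_{si}}` on every
edge. -/
structure Params.Admissible (P : Params G) (qs : Config n m) : Prop where
  rs_pos : ∀ i, 0 < P.rs i
  rs_lt_rc : ∀ i, P.rs i < P.rc i
  rcE_eq : (∀ e, P.rcE e = min (P.rc (edgeFst e)) (P.rc (edgeSnd e))) ∨
    (∀ e, P.rcE e = min (P.rc (edgeFst e) + P.rs (edgeSnd e))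
      (P.rc (edgeSnd e) + P.rs (edgeFst e)))
  /-- the target formation is feasible -/
  rsE_lt : ∀ e, P.rsE e < edgeLen qs e
  lt_rcE : ∀ e, edgeLen qs e < P.rcE e
  mu_pos : 0 < P.mu
  muUp_pos : ∀ e, 0 < P.muUp e
  muUp_le : ∀ e, P.muUp e ≤ P.rcE e - edgeLen qs e
  muLo_pos : ∀ e, 0 < P.muLo e
  muLo_le : ∀ e, P.muLo e ≤ edgeLen qs e - P.rsE e
  rhoInf_pos : ∀ e, 0 < P.rhoInf e
  rhoInf_lt : ∀ e, P.rhoInf e < P.rho0 e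
  a_pos : ∀ e, 0 < P.a e
  k_pos : ∀ e, 0 < P.k e

/-- The distance error `e_{ij} = ‖q_i - q_j‖ - d_{ij}` of the realization `p`, where `d_{ij}` is
the edge length in the target realization `qs`. -/
def distErr (qs p : Config n m) (e : G.edgeSet) : ℝ := edgeLen p e - edgeLen qs e

/-- The squared distance error `η_{ij} = ‖q_i - q_j‖² - d_{ij}²`. -/
def sqErr (qs p : Config n m) (e : G.edgeSet) : ℝ := edgeLen p e ^ 2 - edgeLen qs e ^ 2

/-! ### Selection of the initial bounds from the initial realization `q0` -/

/-- The upper bound of the distance error at time `0`. -/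
def upErr0 (P : Params G) (qs q0 : Config n m) (e : G.edgeSet) : ℝ :=
  if 0 ≤ distErr qs q0 e then min (|distErr qs q0 e| + P.mu) (P.rcE e - edgeLen qs e)
  else min (|distErr qs q0 e| + P.mu) (P.muUp e)

/-- The lower bound (in absolute value) of the distance error at time `0`. -/
def loErr0 (P : Params G) (qs q0 : Config n m) (e : G.edgeSet) : ℝ :=
  if 0 ≤ distErr qs q0 e then min (|distErr qs q0 e| + P.mu) (P.muLo e)
  else min (|distErr qs q0 e| + P.mu) (edgeLen qs e - P.rsE e)

/-- The initial errors belong to `Ω_I` with constant `ϑ`: the sum over the edges of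
`max {|lower bound|, |upper bound|}` is at most `ϑ`. -/
def InOmegaI [Fintype G.edgeSet] (P : Params G) (qs q0 : Config n m) (ϑ : ℝ) : Prop :=
  ∑ e : G.edgeSet, max |loErr0 P qs q0 e| |upErr0 P qs q0 e| ≤ ϑ

/-- `b̄_{ij}`, determined by `ē² + 2 d ē = b̄ ρ₀`. -/
def bUp (P : Params G) (qs q0 : Config n m) (e : G.edgeSet) : ℝ :=
  (upErr0 P qs q0 e ^ 2 + 2 * edgeLen qs e * upErr0 P qs q0 e) / P.rho0 e

/-- `b̲_{ij}`, determined by `2 d e̲ - e̲² = b̲ ρ₀`. -/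
def bLo (P : Params G) (qs q0 : Config n m) (e : G.edgeSet) : ℝ :=
  (2 * edgeLen qs e * loErr0 P qs q0 e - loErr0 P qs q0 e ^ 2) / P.rho0 e

/-! ### The control law -/

/-- The performance function `ρ_{ij}(t) = (ρ₀ - ρ_∞) exp (-a t) + ρ_∞`. -/
def rho (P : Params G) (t : ℝ) (e : G.edgeSet) : ℝ :=
  (P.rho0 e - P.rhoInf e) * Real.exp (-(P.a e) * t) + P.rhoInf e

/-- The modulated error `η̂ = η / ρ`. -/
def modErr (P : Params G) (qs : Config n m) (t : ℝ) (p : Config n m) (e : G.edgeSet) : ℝ :=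
  sqErr qs p e / rho P t e

/-- The transformed error `σ = (1/2) ln ((b̄ η̂ + b̄ b̲) / (b̄ b̲ - b̲ η̂))`; it is meant for
`η̂ ∈ (-b̲, b̄)`. -/
def sigma (P : Params G) (qs q0 : Config n m) (t : ℝ) (p : Config n m) (e : G.edgeSet) : ℝ :=
  1 / 2 * Real.log
    ((bUp P qs q0 e * modErr P qs t p e + bUp P qs q0 e * bLo P qs q0 e) /
      (bUp P qs q0 e * bLo P qs q0 e - bLo P qs q0 e * modErr P qs t p e))

/-- `ξ = (1/ρ) (1 / (η̂ + b̲) - 1 / (η̂ - b̄))`. -/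
def xi (P : Params G) (qs q0 : Config n m) (t : ℝ) (p : Config n m) (e : G.edgeSet) : ℝ :=
  1 / rho P t e *
    (1 / (modErr P qs t p e + bLo P qs q0 e) - 1 / (modErr P qs t p e - bUp P qs q0 e))

/-- The control law `u = -Rᵀ ξ K σ`, at time `t` and realization `p`; `u i` is the velocity input
of agent `i`. -/
def controlLaw [Fintype G.edgeSet] (P : Params G) (qs q0 : Config n m) (t : ℝ) (p : Config n m) :
    Config n m := fun i =>
  WithLp.toLp 2 fun c =>
    (-((rigidityMatrix G p).transpose * Matrix.diagonal (xi P qs q0 t p) * Matrix.diagonal P.k).mulVec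
      (sigma P qs q0 t p)) (i, c)

/-! ### Disturbances and solutions -/

/-- Piecewise continuity on `[0, ∞)`: finitely many discontinuities on bounded intervals, and
one-sided limits everywhere. -/
def PiecewiseContinuous {E : Type*} [TopologicalSpace E] (f : ℝ → E) : Prop :=
  (∀ T : ℝ, {t ∈ Icc 0 T | ¬ ContinuousWithinAt f (Ici 0) t}.Finite) ∧
  (∀ t, 0 ≤ t → ∃ l, Tendsto f (𝓝[>] t) (𝓝 l)) ∧
  (∀ t, 0 < t → ∃ l, Tendsto f (𝓝[<] t) (𝓝 l))

/-- `q` solves the closed loop `q̇ = u + δ`, `q(0) = q0`, on the interval `I` (which is `[0, ∞)` or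
`[0, T)`), in the integral sense, as is appropriate for discontinuous disturbances. -/
def IsSolutionOn [Fintype G.edgeSet] (P : Params G) (qs q0 : Config n m) (δ : ℝ → Config n m)
    (I : Set ℝ) (q : ℝ → Config n m) : Prop :=
  ContinuousOn q I ∧
  ∀ t ∈ I,
    IntervalIntegrable (fun s => controlLaw P qs q0 s (q s) + δ s) volume 0 t ∧
    q t = q0 + ∫ s in (0 : ℝ)..t, (controlLaw P qs q0 s (q s) + δ s)

end Formation

end

namespace Formation

/-! ### Forced differential equations with an invariant set -/

/-! The barrier `V = ∑ k σ²` stays bounded along the motion, and a bound on `V` keeps every `η̂` a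
fixed distance inside `(-b̲, b̄)`. With `z = ξ K σ` the input is `u = -Rᵀ z`, and `V' = -2 ‖Rᵀ z‖² +
2 ⟨Rᵀ z, δ⟩ - ∑ z ρ' η̂`. While the prescribed bounds hold, `δ`, `ρ'` and `η̂` are bounded and
`|z|²` dominates a multiple of `V`. Hence `V' < 0` for large `V`, provided `‖Rᵀ z‖² ≥ λ |z|²` with a
uniform `λ > 0` (`barrierDeriv_neg_of_large`).

Rigidity supplies `λ`. By minimality, infinitesimal rigidity means that `Rᵀ` is injective
(`infRigid_iff`). Every framework with exactly the target lengths is infinitesimally rigid: by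
hypothesis if it is not congruent to the target, and otherwise because `‖Rᵀ z‖` is a congruence
invariant. Modulo translations these frameworks form a compact set, so one `λ` also serves all
frameworks with total length error at most some `ϑ > 0` (`exists_uniform_rigidity`). For `t ≥ 0` one
has `ρ(t) ≤ ρ₀`, so the prescribed bounds are never wider than at the start, and `Ω_I` keeps the
length error below `ϑ` while they hold (`sum_abs_distErr_le`).

The configuration may drift without bound, but the input sees only edge vectors, and over bounded
time the sublevel sets of `V` in (time, edge vectors) are compact (`isCompact_sublevel`).
Subtracting `Δ(t) = ∫₀ᵗ δ` leaves an ODE whose field is `C¹` near such a set. It is replaced by a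
bounded Lipschitz field, solved by Picard–Lindelöf, and invariance of the sublevel set shows that
the replacement is never felt (`exists_isForcedSolution_Icc`). -/

theorem exists_lipschitzWith_eqOn_nhds {X E : Type*} [NormedAddCommGroup X] [NormedSpace ℝ X]
    [FiniteDimensional ℝ X] [NormedAddCommGroup E] [NormedSpace ℝ E] {U C : Set X}
    (hU : IsOpen U) (hC : IsCompact C) (hCU : C ⊆ U) {f : X → E} (hf : ContDiffOn ℝ 1 f U) :
    ∃ (g : X → E) (κ M : NNReal), LipschitzWith κ g ∧ (∀ x, ‖g x‖ ≤ M) ∧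
      ∃ N, IsOpen N ∧ C ⊆ N ∧ N ⊆ U ∧ EqOn g f N := by
  have : ProperSpace X := FiniteDimensional.proper ℝ X
  -- Two nested compacts: a cutoff `χ` equal to `1` on `C₁` and supported in `C₂ ⊆ U` makes `χ • f`
  -- globally `C¹`, whatever `f` is outside `U`.
  obtain ⟨C₁, hC₁, h₁, hC₁U⟩ := exists_compact_between hC hU hCU
  obtain ⟨C₂, hC₂, h₂, hC₂U⟩ := exists_compact_between hC₁ hU hC₁U
  obtain ⟨χ, hχ, -, hsupp, hone⟩ := exists_contMDiff_support_eq_eq_one_iff (n := 1)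
    (modelWithCornersSelf ℝ X) isOpen_interior hC₁.isClosed h₂
  have hχ' : ContDiff ℝ 1 χ := hχ.contDiff
  have hts : tsupport (fun x => χ x • f x) ⊆ C₂ := by
    refine closure_minimal ?_ hC₂.isClosed
    intro x hx
    have : x ∈ Function.support χ := by
      intro h0
      exact hx (by simp [h0])
    rw [hsupp] at this
    exact interior_subset this
  have hcs : HasCompactSupport (fun x => χ x • f x) := hC₂.of_isClosed_subset (isClosed_tsupport _) hts
  have hcd : ContDiff ℝ 1 (fun x => χ x • f x) := by
    rw [contDiff_iff_contDiffAt]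
    intro x
    by_cases hx : x ∈ C₂
    · exact hχ'.contDiffAt.smul (hf.contDiffAt (hU.mem_nhds (hC₂U hx)))
    · have : (fun x => χ x • f x) =ᶠ[𝓝 x] fun _ => 0 := by
        have h' : x ∉ tsupport (fun x => χ x • f x) := fun h => hx (hts h)
        exact notMem_tsupport_iff_eventuallyEq.1 h'
      exact contDiffAt_const.congr_of_eventuallyEq this
  obtain ⟨κ, hκ⟩ := ContDiff.lipschitzWith_of_hasCompactSupport hcs hcd one_ne_zero
  obtain ⟨M, hM⟩ := hcs.exists_bound_of_continuous hcd.continuous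
  refine ⟨_, κ, M.toNNReal, hκ, fun x => (hM x).trans (Real.le_coe_toNNReal M), interior C₁,
    isOpen_interior, h₁, interior_subset.trans hC₁U, fun x hx => ?_⟩
  simp [(hone x).1 (interior_subset hx)]

section Forced

variable {E W : Type*} [NormedAddCommGroup E] [NormedSpace ℝ E]
  [NormedAddCommGroup W] [NormedSpace ℝ W]

/-- `q` is continuous and `q t = q₀ + ∫₀ᵗ f (s, L (q s)) ds + Δ t` on `[0, T]`. -/
def IsForcedSolution (f : ℝ × W → E) (L : E →L[ℝ] W) (Δ : ℝ → E) (q₀ : E) (T : ℝ)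
    (q : ℝ → E) : Prop :=
  ContinuousOn q (Icc 0 T) ∧ ∀ t ∈ Icc 0 T,
    IntervalIntegrable (fun s => f (s, L (q s))) volume 0 t ∧
    q t = q₀ + (∫ s in (0 : ℝ)..t, f (s, L (q s))) + Δ t

theorem IsForcedSolution.mono {f : ℝ × W → E} {L : E →L[ℝ] W} {Δ : ℝ → E} {q₀ : E} {T S : ℝ}
    {q : ℝ → E} (h : IsForcedSolution f L Δ q₀ T q) (hST : S ≤ T) :
    IsForcedSolution f L Δ q₀ S q :=
  ⟨h.1.mono (Icc_subset_Icc_right hST), fun t ht => h.2 t (Icc_subset_Icc_right hST ht)⟩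

theorem continuousOn_graph {L : E →L[ℝ] W} {q : ℝ → E} {s : Set ℝ} (hq : ContinuousOn q s) :
    ContinuousOn (fun s => (s, L (q s))) s :=
  continuousOn_id.prodMk (L.continuous.comp_continuousOn hq)

/-- While the graph stays in `U`, the integrand is continuous, so the fundamental theorem of
calculus applies to `q - Δ`. Subtracting `Δ` removes the discontinuous forcing. -/
theorem IsForcedSolution.hasDerivWithinAt [CompleteSpace E] {f : ℝ × W → E} {L : E →L[ℝ] W}
    {Δ : ℝ → E} {q₀ : E}
    {T a b : ℝ} {q : ℝ → E} {U : Set (ℝ × W)} (h : IsForcedSolution f L Δ q₀ T q)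
    (hf : ContinuousOn f U) (ha : 0 ≤ a) (hb : b ≤ T) (hq : ∀ s ∈ Icc a b, (s, L (q s)) ∈ U) :
    ∀ s ∈ Ico a b, HasDerivWithinAt (fun s => q s - Δ s) (f (s, L (q s))) (Ici s) s := by
  intro s hs
  have hsub : Icc a b ⊆ Icc 0 T := Icc_subset_Icc ha hb
  have hc : ContinuousOn (fun s => f (s, L (q s))) (Icc a b) :=
    hf.comp (continuousOn_graph (h.1.mono hsub)) hq
  have hs' : s ∈ Icc a b := Ico_subset_Icc_self hs
  have hmem : Icc a b ∈ 𝓝[>] s := Icc_mem_nhdsGT_of_mem hs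
  have hd := intervalIntegral.integral_hasDerivWithinAt_right (h.2 s (hsub hs')).1
    (s := Ici s) (t := Ioi s) ⟨_, hmem, hc.aestronglyMeasurable measurableSet_Icc⟩
    ((hc s hs').mono_of_mem_nhdsWithin hmem)
  have hmem' : Icc a b ∈ 𝓝[≥] s := Icc_mem_nhdsGE_of_mem hs
  refine (hd.const_add q₀).congr_of_eventuallyEq ?_ ?_
  · filter_upwards [hmem'] with r hr
    rw [(h.2 r (hsub hr)).2, add_sub_cancel_right]
  · rw [(h.2 s (hsub hs')).2, add_sub_cancel_right]

theorem lipschitzWith_forcedField {g : ℝ × W → E} {κ : NNReal} (hg : LipschitzWith κ g)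
    (L : E →L[ℝ] W) (Δ : ℝ → E) (t : ℝ) :
    LipschitzWith (κ * ‖L‖₊) (fun y => g (t, L (y + Δ t))) := by
  refine hg.comp ?_
  have h1 : LipschitzWith ‖L‖₊ (fun y => L (y + Δ t)) := by
    refine LipschitzWith.of_dist_le_mul fun x y => ?_
    have := L.lipschitz.dist_le_mul (x + Δ t) (y + Δ t)
    rwa [dist_add_right] at this
  refine LipschitzWith.of_dist_le_mul fun x y => ?_
  rw [dist_prod_same_left]
  exact h1.dist_le_mul x y

variable [FiniteDimensional ℝ E] [FiniteDimensional ℝ W]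

/-- Only `q` is assumed to stay in `K`; the competitor `q'` may a priori leave `U`. The set of
agreement is closed, and after a time of agreement both graphs remain briefly in the neighbourhood
where `f` is Lipschitz, so agreement propagates to the right. -/
theorem IsForcedSolution.eqOn {f : ℝ × W → E} {L : E →L[ℝ] W} {Δ : ℝ → E} {q₀ : E}
    {T : ℝ} {q q' : ℝ → E} {U K : Set (ℝ × W)} (hU : IsOpen U) (hf : ContDiffOn ℝ 1 f U)
    (hKU : K ⊆ U) (hK : IsCompact (K ∩ Icc 0 T ×ˢ univ)) (hΔ : ContinuousOn Δ (Icc 0 T))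
    (h : IsForcedSolution f L Δ q₀ T q) (h' : IsForcedSolution f L Δ q₀ T q')
    (hq : ∀ t ∈ Icc 0 T, (t, L (q t)) ∈ K) : EqOn q' q (Icc 0 T) := by
  have : CompleteSpace E := FiniteDimensional.complete ℝ E
  rcases lt_or_ge T 0 with hT | hT
  · simp [Icc_eq_empty_of_lt hT]
  obtain ⟨g, κ, M, hg, -, N, hN, hKN, hNU, hgf⟩ := exists_lipschitzWith_eqOn_nhds hU hK
    (inter_subset_left.trans hKU) hf
  have key : Icc 0 T ⊆ {t | q' t = q t} := by
    apply IsClosed.Icc_subset_of_forall_mem_nhdsWithin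
    · have : {t | q' t = q t} ∩ Icc 0 T = Icc 0 T ∩ (fun t => q' t - q t) ⁻¹' {0} := by
        ext t
        simp [sub_eq_zero, and_comm]
      rw [this]
      exact (h'.1.sub h.1).preimage_isClosed_of_isClosed isClosed_Icc isClosed_singleton
    · have h0 : (0 : ℝ) ∈ Icc 0 T := ⟨le_rfl, hT⟩
      show q' 0 = q 0
      rw [(h.2 0 h0).2, (h'.2 0 h0).2]
      simp
    · rintro t ⟨htq, ht⟩
      have ht' : t ∈ Icc 0 T := Ico_subset_Icc_self ht
      have hev : ∀ p : ℝ → E, ContinuousOn p (Icc 0 T) → p t = q t →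
          ∀ᶠ s in 𝓝[≥] t, (s, L (p s)) ∈ N := by
        intro p hp hpt
        have hcw := ((continuousOn_graph (L := L) hp) t ht').mono_of_mem_nhdsWithin
          (Icc_mem_nhdsGE_of_mem ht)
        refine hcw.eventually (hN.mem_nhds (hKN ⟨?_, ?_⟩))
        · simpa only [hpt] using hq t ht'
        · exact ⟨ht', mem_univ _⟩
      have hevT : ∀ᶠ s in 𝓝[≥] t, s < T := by
        exact mem_nhdsWithin_of_mem_nhds (Iio_mem_nhds ht.2)
      obtain ⟨b, hb, hbs⟩ := mem_nhdsGE_iff_exists_Icc_subset.1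
        ((hev q h.1 rfl).and ((hev q' h'.1 htq).and hevT))
      have hbT : b < T := (hbs ⟨le_of_lt hb, le_rfl⟩).2.2
      have hsub : Icc t b ⊆ Icc 0 T := Icc_subset_Icc ht.1 hbT.le
      have hdq := h.hasDerivWithinAt (hf.continuousOn.mono hNU) ht.1 hbT.le
        (fun s hs => (hbs hs).1)
      have hdq' := h'.hasDerivWithinAt (hf.continuousOn.mono hNU) ht.1 hbT.le
        (fun s hs => (hbs hs).2.1)
      have hun := ODE_solution_unique_of_mem_Icc_right (a := t) (b := b)
        (v := fun t y => g (t, L (y + Δ t))) (s := fun _ => univ)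
        (f := fun s => q' s - Δ s) (g := fun s => q s - Δ s)
        (fun s _ => (lipschitzWith_forcedField hg L Δ s).lipschitzOnWith)
        ((h'.1.mono hsub).sub (hΔ.mono hsub))
        (fun s hs => by
          have := hdq' s hs
          rw [← hgf (hbs (Ico_subset_Icc_self hs)).2.1] at this
          simpa using this) (fun _ _ => mem_univ _)
        ((h.1.mono hsub).sub (hΔ.mono hsub))
        (fun s hs => by
          have := hdq s hs
          rw [← hgf (hbs (Ico_subset_Icc_self hs)).1] at this
          simpa using this) (fun _ _ => mem_univ _)
        (by
          have : q' t = q t := htq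
          simp [this])
      filter_upwards [Icc_mem_nhdsGT hb] with s hs
      have := hun hs
      simpa using this
  exact key

/-- Solutions that stay in `U` cannot leave `K`. -/
def IsForwardInvariant (f : ℝ × W → E) (L : E →L[ℝ] W) (Δ : ℝ → E) (U K : Set (ℝ × W)) : Prop :=
  ∀ (a b : ℝ) (q : ℝ → E), 0 ≤ a → ContinuousOn q (Icc a b) →
    (∀ s ∈ Icc a b, (s, L (q s)) ∈ U) →
    (∀ s ∈ Ico a b, HasDerivWithinAt (fun s => q s - Δ s) (f (s, L (q s))) (Ici s) s) →
    (a, L (q a)) ∈ K → ∀ s ∈ Icc a b, (s, L (q s)) ∈ K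

theorem exists_isForcedSolution_Icc {f : ℝ × W → E} {L : E →L[ℝ] W} {Δ : ℝ → E} {q₀ : E}
    {T : ℝ} {U K : Set (ℝ × W)} (hU : IsOpen U) (hf : ContDiffOn ℝ 1 f U)
    (hKU : K ⊆ U) (hK : IsCompact (K ∩ Icc 0 T ×ˢ univ)) (hΔ : ContinuousOn Δ (Icc 0 T))
    (hΔ0 : Δ 0 = 0) (hinv : IsForwardInvariant f L Δ U K) (h0 : (0, L q₀) ∈ K) (hT : 0 ≤ T) :
    ∃ q, IsForcedSolution f L Δ q₀ T q ∧ ∀ t ∈ Icc 0 T, (t, L (q t)) ∈ K := by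
  have : CompleteSpace E := FiniteDimensional.complete ℝ E
  obtain ⟨g, κ, M, hg, hgM, N, hN, hKN, hNU, hgf⟩ := exists_lipschitzWith_eqOn_nhds hU hK
    (inter_subset_left.trans hKU) hf
  -- The unknown is `y = q - Δ`. As `g` is bounded by `M`, a ball of radius `M T` suffices for a
  -- solution on all of `[0, T]`.
  have hPL : IsPicardLindelof (fun t y => g (t, L (y + Δ t))) (tmin := 0) (tmax := T)
      ⟨0, le_rfl, hT⟩ q₀ (M * T.toNNReal) 0 M (κ * ‖L‖₊) := by
    refine ⟨fun t _ => (lipschitzWith_forcedField hg L Δ t).lipschitzOnWith, fun x _ => ?_,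
      fun t _ x _ => hgM _, ?_⟩
    · exact hg.continuous.comp_continuousOn (continuousOn_graph (continuousOn_const.add hΔ))
    · simp [hT]
  obtain ⟨y, hy0, hy⟩ := hPL.exists_eq_forall_mem_Icc_hasDerivWithinAt₀
  simp only at hy0
  have hyc : ContinuousOn y (Icc 0 T) := fun t ht => (hy t ht).continuousWithinAt
  set q : ℝ → E := fun t => y t + Δ t with hqdef
  have hqc : ContinuousOn q (Icc 0 T) := hyc.add hΔ
  have hyq : (fun s => q s - Δ s) = y := by
    funext s; simp [hqdef]
  have hq0 : q 0 = q₀ := by simp [hqdef, hΔ0, hy0]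
  -- Continuous induction: from a point of `K` the solution stays in `N` for a short time, where `g
  -- = f`, and there invariance of `K` applies.
  have key : Icc 0 T ⊆ {t | (t, L (q t)) ∈ K} := by
    apply IsClosed.Icc_subset_of_forall_mem_nhdsWithin
    · have : {t | (t, L (q t)) ∈ K} ∩ Icc 0 T
          = Icc 0 T ∩ (fun t => (t, L (q t))) ⁻¹' (K ∩ Icc 0 T ×ˢ univ) := by
        ext t
        simp [and_comm]
      rw [this]
      exact (continuousOn_graph hqc).preimage_isClosed_of_isClosed isClosed_Icc hK.isClosed
    · simpa [hq0] using h0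
    · rintro t ⟨htq, ht⟩
      have ht' : t ∈ Icc 0 T := Ico_subset_Icc_self ht
      have hev : ∀ᶠ s in 𝓝[≥] t, (s, L (q s)) ∈ N :=
        (((continuousOn_graph (L := L) hqc) t ht').mono_of_mem_nhdsWithin
          (Icc_mem_nhdsGE_of_mem ht)).eventually (hN.mem_nhds (hKN ⟨htq, ht', mem_univ _⟩))
      have hevT : ∀ᶠ s in 𝓝[≥] t, s < T := mem_nhdsWithin_of_mem_nhds (Iio_mem_nhds ht.2)
      obtain ⟨b, hb, hbs⟩ := mem_nhdsGE_iff_exists_Icc_subset.1 (hev.and hevT)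
      have hbT : b < T := (hbs ⟨le_of_lt hb, le_rfl⟩).2
      have hK' := hinv t b q ht.1 (hqc.mono (Icc_subset_Icc ht.1 hbT.le))
        (fun s hs => hNU (hbs hs).1) (fun s hs => by
          have hs' : s ∈ Icc 0 T := ⟨ht.1.trans hs.1, (hs.2.trans hbT).le⟩
          rw [hyq, ← hgf (hbs (Ico_subset_Icc_self hs)).1]
          exact (hy s hs').mono_of_mem_nhdsWithin
            (Icc_mem_nhdsGE_of_mem ⟨hs'.1, hs.2.trans hbT⟩)) htq
      filter_upwards [Icc_mem_nhdsGT hb] with s hs using hK' s hs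
  refine ⟨q, ⟨hqc, fun t ht => ?_⟩, key⟩
  have hsub : Icc 0 t ⊆ Icc 0 T := Icc_subset_Icc_right ht.2
  have hcf : ContinuousOn (fun s => f (s, L (q s))) (Icc 0 t) :=
    hf.continuousOn.comp (continuousOn_graph (hqc.mono hsub)) fun s hs => hKU (key (hsub hs))
  have hint : IntervalIntegrable (fun s => f (s, L (q s))) volume 0 t :=
    hcf.intervalIntegrable_of_Icc ht.1
  refine ⟨hint, ?_⟩
  rw [intervalIntegral.integral_eq_sub_of_hasDeriv_right_of_le ht.1 (hyc.mono hsub)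
    (fun s hs => ?_) hint, hy0]
  · simp [hqdef]
  · have hs' : s ∈ Icc 0 T := ⟨hs.1.le, hs.2.le.trans ht.2⟩
    rw [← hgf (hKN ⟨key hs', hs', mem_univ _⟩)]
    exact (hy s hs').mono_of_mem_nhdsWithin
      (Icc_mem_nhdsGT_of_mem ⟨hs'.1, hs.2.trans_le ht.2⟩)

theorem exists_isForcedSolution {f : ℝ × W → E} {L : E →L[ℝ] W} {Δ : ℝ → E} {q₀ : E}
    {U K : Set (ℝ × W)} (hU : IsOpen U) (hf : ContDiffOn ℝ 1 f U)
    (hKU : K ⊆ U) (hK : ∀ T, IsCompact (K ∩ Icc 0 T ×ˢ univ)) (hΔ : ContinuousOn Δ (Ici 0))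
    (hΔ0 : Δ 0 = 0) (hinv : IsForwardInvariant f L Δ U K) (h0 : (0, L q₀) ∈ K) :
    ∃ q, (∀ T, IsForcedSolution f L Δ q₀ T q) ∧ ∀ t, 0 ≤ t → (t, L (q t)) ∈ K := by
  have hΔT : ∀ T, ContinuousOn Δ (Icc 0 T) := fun T => hΔ.mono Icc_subset_Ici_self
  have hex : ∀ T : ℝ, ∃ q, 0 ≤ T →
      IsForcedSolution f L Δ q₀ T q ∧ ∀ t ∈ Icc 0 T, (t, L (q t)) ∈ K := by
    intro T
    by_cases hT : 0 ≤ T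
    · obtain ⟨q, hq⟩ := exists_isForcedSolution_Icc hU hf hKU (hK T) (hΔT T) hΔ0 hinv h0 hT
      exact ⟨q, fun _ => hq⟩
    · exact ⟨0, fun h => absurd h hT⟩
  choose Q hQ using hex
  have hEq : ∀ T t : ℝ, 0 ≤ t → t ≤ T → Q t t = Q T t := by
    intro T t ht htT
    have hT := hQ T (ht.trans htT)
    exact IsForcedSolution.eqOn hU hf hKU (hK t) (hΔT t) (hT.1.mono htT) (hQ t ht).1
      (fun s hs => hT.2 s ⟨hs.1, hs.2.trans htT⟩) ⟨ht, le_rfl⟩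
  -- The solutions on `[0, T]` agree where they overlap, so the diagonal glues them.
  refine ⟨fun t => Q t t, fun T => ?_, fun t ht => (hQ t ht).2 t ⟨ht, le_rfl⟩⟩
  rcases lt_or_ge T 0 with hT | hT
  · simp [IsForcedSolution, Icc_eq_empty_of_lt hT]
  obtain ⟨⟨hc, hs⟩, -⟩ := hQ T hT
  refine ⟨hc.congr fun t ht => hEq T t ht.1 ht.2, fun t ht => ?_⟩
  have hcongr : ∀ s ∈ uIcc 0 t, f (s, L (Q s s)) = f (s, L (Q T s)) := by
    intro s hs
    rw [uIcc_of_le ht.1] at hs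
    rw [hEq T s hs.1 (hs.2.trans ht.2)]
  refine ⟨(hs t ht).1.congr fun s hs => (hcongr s (uIoc_subset_uIcc hs)).symm, ?_⟩
  rw [intervalIntegral.integral_congr hcongr]
  exact (hEq T t ht.1 ht.2).trans (hs t ht).2

end Forced


/-! ### The rigidity matrix in terms of edge vectors -/

variable {n m : ℕ} {G : SimpleGraph (Fin n)}

theorem edgeFst_ne_edgeSnd (e : G.edgeSet) : edgeFst e ≠ edgeSnd e := by
  obtain ⟨e, he⟩ := e
  induction e using Sym2.ind with
  | _ i j =>
    have hij : i ≠ j := G.ne_of_adj he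
    simpa [edgeFst, edgeSnd] using hij

/-- Incidence coefficients of the oriented edges. -/
def inc (e : G.edgeSet) (i : Fin n) : ℝ :=
  if i = edgeFst e then 1 else if i = edgeSnd e then -1 else 0

theorem rigidityMatrix_apply (p : Config n m) (e : G.edgeSet) (v : Fin n × Fin m) :
    rigidityMatrix G p e v = inc e v.1 * edgeVec p e v.2 := by
  simp only [rigidityMatrix, inc, Matrix.of_apply]
  split_ifs <;> simp

theorem sum_inc_smul {E : Type*} [AddCommGroup E] [Module ℝ E] (e : G.edgeSet) (x : Fin n → E) :
    ∑ i, inc e i • x i = x (edgeFst e) - x (edgeSnd e) := by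
  have h : ∀ i, inc e i • x i
      = (if i = edgeFst e then x i else 0) - (if i = edgeSnd e then x i else 0) := by
    intro i
    by_cases h1 : i = edgeFst e
    · have h2 : i ≠ edgeSnd e := h1 ▸ edgeFst_ne_edgeSnd e
      simp [inc, h1, edgeFst_ne_edgeSnd e]
    · by_cases h2 : i = edgeSnd e
      · simp [inc, h2, (edgeFst_ne_edgeSnd e).symm]
      · simp [inc, h1, h2]
  simp [h, Finset.sum_sub_distrib]

/-- Polarization: inner products of differences are determined by pairwise distances. -/
theorem Congruent.inner_edgeVec_eq {p q : Config n m} (h : Congruent p q) (e f : G.edgeSet) :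
    inner ℝ (edgeVec p e) (edgeVec p f) = inner ℝ (edgeVec q e) (edgeVec q f) := by
  have key : ∀ a b c d : EuclideanSpace ℝ (Fin m), inner ℝ (a - b) (c - d)
      = (‖a - d‖ ^ 2 + ‖b - c‖ ^ 2 - ‖a - c‖ ^ 2 - ‖b - d‖ ^ 2) / 2 := by
    intro a b c d
    simp only [norm_sub_sq_real, inner_sub_left, inner_sub_right]
    ring
  simp only [edgeVec, key, h _ _]

/-- The edge vectors of a framework, as a linear map. -/
def edgeVecL (n m : ℕ) (G : SimpleGraph (Fin n)) [Fintype G.edgeSet] :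
    Config n m →L[ℝ] (G.edgeSet → EuclideanSpace ℝ (Fin m)) :=
  ContinuousLinearMap.pi fun e =>
    ContinuousLinearMap.proj (R := ℝ) (φ := fun _ : Fin n => EuclideanSpace ℝ (Fin m)) (edgeFst e) -
      ContinuousLinearMap.proj (edgeSnd e)

variable [Fintype G.edgeSet]

@[simp]
theorem edgeVecL_apply (p : Config n m) (e : G.edgeSet) : edgeVecL n m G p e = edgeVec p e := rfl

/-- The product of the transpose of the rigidity matrix with edge vectors `w` and a vector `z`. -/
def stressForce (w : G.edgeSet → EuclideanSpace ℝ (Fin m)) (z : G.edgeSet → ℝ) : Config n m :=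
  fun i => ∑ e, (z e * inc e i) • w e

theorem transpose_mulVec_apply (p : Config n m) (z : G.edgeSet → ℝ) (i : Fin n) (c : Fin m) :
    ((rigidityMatrix G p).transpose.mulVec z) (i, c) = stressForce (edgeVecL n m G p) z i c := by
  simp only [Matrix.mulVec, dotProduct, Matrix.transpose_apply, rigidityMatrix_apply, stressForce,
    WithLp.ofLp_sum, Finset.sum_apply, WithLp.ofLp_smul, Pi.smul_apply, smul_eq_mul, edgeVecL_apply]
  exact Finset.sum_congr rfl fun e _ => by ring

theorem stressForce_smul (w : G.edgeSet → EuclideanSpace ℝ (Fin m)) (c : ℝ) (z : G.edgeSet → ℝ) :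
    stressForce w (c • z) = c • stressForce w z := by
  funext i
  simp [stressForce, Finset.smul_sum, smul_smul, mul_assoc]

/-- The adjunction `⟨Rᵀ z, v⟩ = ⟨z, R v⟩`, by which the feedback produces `-‖Rᵀ z‖²` in the
derivative of the barrier. -/
theorem sum_inner_stressForce (w : G.edgeSet → EuclideanSpace ℝ (Fin m)) (z : G.edgeSet → ℝ)
    (v : Config n m) :
    ∑ i, inner ℝ (stressForce w z i) (v i) = ∑ e, z e * inner ℝ (w e) (edgeVec v e) := by
  simp only [stressForce, sum_inner, inner_smul_left]
  rw [Finset.sum_comm]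
  refine Finset.sum_congr rfl fun e _ => ?_
  rw [edgeVec, ← sum_inc_smul, inner_sum, Finset.mul_sum]
  refine Finset.sum_congr rfl fun i _ => ?_
  simp [inner_smul_right, mul_assoc]

theorem rank_eq_card_iff (p : Config n m) :
    (rigidityMatrix G p).rank = Fintype.card G.edgeSet ↔
      ∀ z, stressForce (edgeVecL n m G p) z = 0 → z = 0 := by
  have h1 : (rigidityMatrix G p).rank = Fintype.card G.edgeSet ↔
      Function.Injective (rigidityMatrix G p).transpose.mulVecLin := by
    rw [← Matrix.rank_transpose, Matrix.rank, ← LinearMap.ker_eq_bot]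
    have := LinearMap.finrank_range_add_finrank_ker (rigidityMatrix G p).transpose.mulVecLin
    rw [Module.finrank_pi] at this
    rw [← Submodule.finrank_eq_zero (R := ℝ)]
    omega
  rw [h1, injective_iff_map_eq_zero]
  refine forall_congr' fun z => ?_
  have : (rigidityMatrix G p).transpose.mulVecLin z = 0 ↔
      stressForce (edgeVecL n m G p) z = 0 := by
    constructor
    · intro h
      funext i
      ext c
      rw [← transpose_mulVec_apply]
      exact congrFun h (i, c)
    · intro h
      funext ⟨i, c⟩
      rw [Matrix.mulVecLin_apply, transpose_mulVec_apply, h]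
      rfl
  rw [this]

/-- Minimality makes the required rank equal to the number of edges, so rigidity is full row rank.
-/
theorem infRigid_iff {qs : Config n m} (h : MinInfRigid G qs) (p : Config n m) :
    InfRigid G p ↔ ∀ z, stressForce (edgeVecL n m G p) z = 0 → z = 0 := by
  rw [← rank_eq_card_iff, InfRigid]
  have := h.2
  omega

theorem sum_norm_sq_stressForce (w : G.edgeSet → EuclideanSpace ℝ (Fin m)) (z : G.edgeSet → ℝ) :
    ∑ i, ‖stressForce w z i‖ ^ 2
      = ∑ i, ∑ e, ∑ f, z e * inc e i * (z f * inc f i) * inner ℝ (w e) (w f) := by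
  refine Finset.sum_congr rfl fun i _ => ?_
  rw [← real_inner_self_eq_norm_sq, stressForce, sum_inner]
  refine Finset.sum_congr rfl fun e _ => ?_
  rw [inner_sum]
  refine Finset.sum_congr rfl fun f _ => ?_
  rw [real_inner_smul_left, real_inner_smul_right]
  ring

theorem sum_norm_sq_eq_zero_iff (v : Config n m) : ∑ i, ‖v i‖ ^ 2 = 0 ↔ v = 0 := by
  rw [Finset.sum_eq_zero_iff_of_nonneg (fun _ _ => sq_nonneg _)]
  simp [funext_iff]

/-- `‖Rᵀ z‖²` depends on the framework only through the Gram matrix of its edge vectors, so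
congruent frameworks have the same kernel of `Rᵀ`. -/
theorem Congruent.infRigid {p q qs : Config n m} (h : MinInfRigid G qs) (hpq : Congruent p q)
    (hq : InfRigid G q) : InfRigid G p := by
  rw [infRigid_iff h] at hq ⊢
  intro z hz
  apply hq
  rw [← sum_norm_sq_eq_zero_iff, sum_norm_sq_stressForce] at hz ⊢
  simpa [hpq.inner_edgeVec_eq] using hz

/-! ### Compactness and uniform rigidity near the target lengths -/

theorem continuous_stressForce :
    Continuous fun x : (G.edgeSet → EuclideanSpace ℝ (Fin m)) × (G.edgeSet → ℝ) =>
      stressForce x.1 x.2 := by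
  unfold stressForce
  fun_prop

theorem sum_sq_eq_zero_iff (z : G.edgeSet → ℝ) : ∑ e, z e ^ 2 = 0 ↔ z = 0 := by
  rw [Finset.sum_eq_zero_iff_of_nonneg (fun _ _ => sq_nonneg _)]
  simp [funext_iff]

/-- Near the target edge lengths, frameworks are rigid with a uniform lower bound. -/
theorem exists_uniform_rigidity {qs : Config n m} (h : MinInfRigid G qs)
    (hamb : AmbiguitiesInfRigid G qs) :
    ∃ ϑ : ℝ, 0 < ϑ ∧ ∃ lam : ℝ, 0 < lam ∧ ∀ p : Config n m,
      ∑ e : G.edgeSet, |distErr qs p e| ≤ ϑ → ∀ z : G.edgeSet → ℝ,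
        lam * ∑ e, z e ^ 2 ≤ ∑ i, ‖stressForce (edgeVecL n m G p) z i‖ ^ 2 := by
  let D : (G.edgeSet → EuclideanSpace ℝ (Fin m)) → ℝ := fun w => ∑ e, |‖w e‖ - edgeLen qs e|
  -- Passing to edge vectors removes translations, so a bound on the lengths gives compactness. The
  -- cutoff `1` is arbitrary.
  let Y : Set (G.edgeSet → EuclideanSpace ℝ (Fin m)) :=
    {w | w ∈ LinearMap.range (edgeVecL n m G).toLinearMap ∧ D w ≤ 1}
  let S : Set (G.edgeSet → ℝ) := {z | ∑ e, z e ^ 2 = 1}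
  have hDc : Continuous D := by fun_prop
  have hY : IsCompact Y := by
    refine Metric.isCompact_of_isClosed_isBounded ?_ ?_
    · exact (Submodule.closed_of_finiteDimensional _).inter (isClosed_le hDc continuous_const)
    · refine (Metric.isBounded_closedBall (x := 0) (r := ∑ e : G.edgeSet, edgeLen qs e + 1)).subset
        fun w hw => ?_
      have hpos : ∀ e : G.edgeSet, 0 ≤ edgeLen qs e := fun e => norm_nonneg _
      rw [mem_closedBall_zero_iff, pi_norm_le_iff_of_nonneg
        (add_nonneg (Finset.sum_nonneg fun e _ => hpos e) zero_le_one)]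
      intro e
      have h1 : |‖w e‖ - edgeLen qs e| ≤ D w :=
        Finset.single_le_sum (f := fun e => |‖w e‖ - edgeLen qs e|) (fun _ _ => abs_nonneg _)
          (Finset.mem_univ e)
      have h2 : edgeLen qs e ≤ ∑ e : G.edgeSet, edgeLen qs e :=
        Finset.single_le_sum (fun e _ => hpos e) (Finset.mem_univ e)
      have h3 := hw.2
      have h4 := le_abs_self (‖w e‖ - edgeLen qs e)
      linarith
  have hS : IsCompact S := by
    refine Metric.isCompact_of_isClosed_isBounded ?_ ?_
    · exact isClosed_eq (by fun_prop) continuous_const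
    · refine (Metric.isBounded_closedBall (x := 0) (r := 1)).subset fun z hz => ?_
      rw [mem_closedBall_zero_iff, pi_norm_le_iff_of_nonneg zero_le_one]
      intro e
      have h1 : z e ^ 2 ≤ ∑ e, z e ^ 2 :=
        Finset.single_le_sum (f := fun e => z e ^ 2) (fun _ _ => sq_nonneg _) (Finset.mem_univ e)
      have h2 : ∑ e, z e ^ 2 = 1 := hz
      rw [Real.norm_eq_abs]
      exact abs_le_one_iff_mul_self_le_one.2 (by nlinarith)
  -- The length error `D` is added as a penalty: `F` can vanish only at exact target lengths, where
  -- rigidity excludes a unit `z` with `Rᵀ z = 0`.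
  let F : (G.edgeSet → EuclideanSpace ℝ (Fin m)) × (G.edgeSet → ℝ) → ℝ :=
    fun x => ∑ i, ‖stressForce x.1 x.2 i‖ ^ 2 + D x.1
  have hFc : Continuous F := by
    have := continuous_stressForce (G := G) (m := m)
    fun_prop
  have hD0 : ∀ w, 0 ≤ D w := fun w => Finset.sum_nonneg fun _ _ => abs_nonneg _
  have hFpos : ∀ x ∈ Y ×ˢ S, 0 < F x := by
    rintro ⟨w, z⟩ ⟨⟨⟨p, hp⟩, -⟩, hz⟩
    have hp' : edgeVecL n m G p = w := hp
    subst hp'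
    have h1 : 0 ≤ ∑ i, ‖stressForce (edgeVecL n m G p) z i‖ ^ 2 :=
      Finset.sum_nonneg fun _ _ => sq_nonneg _
    refine lt_of_le_of_ne (add_nonneg h1 (hD0 _)) fun h0 => ?_
    have h2 := hD0 (edgeVecL n m G p)
    have h3 : ∑ i, ‖stressForce (edgeVecL n m G p) z i‖ ^ 2 + D (edgeVecL n m G p) = 0 := h0.symm
    have hD : D (edgeVecL n m G p) = 0 := by linarith
    have hst : ∑ i, ‖stressForce (edgeVecL n m G p) z i‖ ^ 2 = 0 := by linarith
    have hequiv : Equivalent G p qs := by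
      intro e
      have := (Finset.sum_eq_zero_iff_of_nonneg (fun _ _ => abs_nonneg _)).1 hD e
        (Finset.mem_univ e)
      exact sub_eq_zero.1 (abs_eq_zero.1 this)
    have hr : InfRigid G p := by
      by_cases hc : Congruent p qs
      · exact hc.infRigid h h.1
      · exact hamb p hequiv hc
    have hz0 : z = 0 := (infRigid_iff h p).1 hr z ((sum_norm_sq_eq_zero_iff _).1 hst)
    have hz1 : ∑ e, z e ^ 2 = 1 := hz
    rw [(sum_sq_eq_zero_iff z).2 hz0] at hz1
    exact zero_ne_one hz1
  obtain ⟨c, hc, hcF⟩ := (hY.prod hS).exists_forall_le' hFc.continuousOn hFpos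
  -- The bound `1` keeps `w` in `Y`; the bound `c / 2` on the penalty leaves at least `c / 2` of the
  -- minimum `c` for `‖Rᵀ z‖²`.
  refine ⟨min 1 (c / 2), by positivity, c / 2, by positivity, fun p hp z => ?_⟩
  by_cases hz : ∑ e, z e ^ 2 = 0
  · rw [hz, mul_zero]
    exact Finset.sum_nonneg fun _ _ => sq_nonneg _
  have hzpos : 0 < ∑ e, z e ^ 2 :=
    lt_of_le_of_ne (Finset.sum_nonneg fun _ _ => sq_nonneg _) (Ne.symm hz)
  -- Both sides are quadratic in `z`, so it may be scaled to the unit sphere.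
  set s := Real.sqrt (∑ e, z e ^ 2) with hs
  have hspos : 0 < s := Real.sqrt_pos.2 hzpos
  have hs2 : s ^ 2 = ∑ e, z e ^ 2 := Real.sq_sqrt hzpos.le
  have hpD : D (edgeVecL n m G p) ≤ min 1 (c / 2) := hp
  have hzS : s⁻¹ • z ∈ S := by
    show ∑ e, (s⁻¹ • z) e ^ 2 = 1
    simp only [Pi.smul_apply, smul_eq_mul, mul_pow, ← Finset.mul_sum, ← hs2]
    field_simp
  have h1 := hcF (edgeVecL n m G p, s⁻¹ • z)
    ⟨⟨⟨p, rfl⟩, hpD.trans (min_le_left _ _)⟩, hzS⟩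
  have h2 : c ≤ ∑ i, ‖stressForce (edgeVecL n m G p) (s⁻¹ • z) i‖ ^ 2 + D (edgeVecL n m G p) := h1
  have h3 : D (edgeVecL n m G p) ≤ c / 2 := hpD.trans (min_le_right _ _)
  have h4 : ∑ i, ‖stressForce (edgeVecL n m G p) (s⁻¹ • z) i‖ ^ 2
      = (s ^ 2)⁻¹ * ∑ i, ‖stressForce (edgeVecL n m G p) z i‖ ^ 2 := by
    rw [stressForce_smul, Finset.mul_sum]
    refine Finset.sum_congr rfl fun i _ => ?_
    rw [Pi.smul_apply, norm_smul, mul_pow, norm_inv, Real.norm_of_nonneg hspos.le, inv_pow]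
  have h5 : c / 2 ≤ (s ^ 2)⁻¹ * ∑ i, ‖stressForce (edgeVecL n m G p) z i‖ ^ 2 := by
    rw [← h4]; linarith
  rw [← hs2]
  have h6 := mul_le_mul_of_nonneg_right h5 (sq_nonneg s)
  have h7 : (s ^ 2)⁻¹ * (∑ i, ‖stressForce (edgeVecL n m G p) z i‖ ^ 2) * s ^ 2
      = ∑ i, ‖stressForce (edgeVecL n m G p) z i‖ ^ 2 := by
    field_simp
  linarith


/-! ### Initial bounds and performance functions -/

theorem exists_pos_forall_le {ι : Type*} [Finite ι] (f : ι → ℝ) (hf : ∀ i, 0 < f i) :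
    ∃ c : ℝ, 0 < c ∧ ∀ i, c ≤ f i := by
  rcases isEmpty_or_nonempty ι with h | h
  · exact ⟨1, one_pos, fun i => h.elim i⟩
  · obtain ⟨i, hi⟩ := Finite.exists_min f
    exact ⟨f i, hf i, hi⟩

theorem exists_forall_le {ι : Type*} [Finite ι] (f : ι → ℝ) : ∃ C : ℝ, ∀ i, f i ≤ C := by
  obtain ⟨C, hC⟩ := (Set.finite_range f).bddAbove
  exact ⟨C, fun i => hC ⟨i, rfl⟩⟩

section InitialBounds

variable {n m : ℕ} {G : SimpleGraph (Fin n)} {P : Params G} {qs q0 : Config n m}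

theorem Params.Admissible.rsE_pos (hP : P.Admissible qs) (e : G.edgeSet) : 0 < P.rsE e :=
  add_pos (hP.rs_pos _) (hP.rs_pos _)

theorem upErr0_pos (hP : P.Admissible qs) (e : G.edgeSet) : 0 < upErr0 P qs q0 e := by
  have h1 := hP.mu_pos
  have h2 := hP.lt_rcE e
  have h3 := hP.muUp_pos e
  have h4 := abs_nonneg (distErr qs q0 e)
  unfold upErr0
  split_ifs <;> exact lt_min (by linarith) (by linarith)

theorem loErr0_pos (hP : P.Admissible qs) (e : G.edgeSet) : 0 < loErr0 P qs q0 e := by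
  have h1 := hP.mu_pos
  have h2 := hP.rsE_lt e
  have h3 := hP.muLo_pos e
  have h4 := abs_nonneg (distErr qs q0 e)
  unfold loErr0
  split_ifs <;> exact lt_min (by linarith) (by linarith)

theorem upErr0_le (hP : P.Admissible qs) (e : G.edgeSet) :
    upErr0 P qs q0 e ≤ P.rcE e - edgeLen qs e := by
  unfold upErr0
  split_ifs
  · exact min_le_right _ _
  · exact (min_le_right _ _).trans (hP.muUp_le e)

theorem loErr0_le (hP : P.Admissible qs) (e : G.edgeSet) :
    loErr0 P qs q0 e ≤ edgeLen qs e - P.rsE e := by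
  unfold loErr0
  split_ifs
  · exact (min_le_right _ _).trans (hP.muLo_le e)
  · exact min_le_right _ _

/-- Since `r_{sij} > 0`, the lower length bound `d - e̲` is positive. This makes `b̲` positive and
lets the initial lower bound be squared. -/
theorem loErr0_lt_edgeLen (hP : P.Admissible qs) (e : G.edgeSet) :
    loErr0 P qs q0 e < edgeLen qs e := by
  have h1 := loErr0_le (q0 := q0) hP e
  have h2 := hP.rsE_pos e
  linarith

/-- The robustness constant enters the upper bound only for a negative error, where positivity of
the bound is enough; otherwise `μ > 0` and the initial range condition give strictness. -/
theorem distErr_lt_upErr0 (hP : P.Admissible qs) {e : G.edgeSet} (h0 : edgeLen q0 e < P.rcE e) :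
    distErr qs q0 e < upErr0 P qs q0 e := by
  by_cases h : 0 ≤ distErr qs q0 e
  · have h1 := hP.mu_pos
    have h2 := le_abs_self (distErr qs q0 e)
    rw [upErr0, if_pos h]
    exact lt_min (by linarith) (by unfold distErr; linarith)
  · exact (not_le.1 h).trans (upErr0_pos hP e)

theorem neg_loErr0_lt_distErr (hP : P.Admissible qs) {e : G.edgeSet}
    (h0 : P.rsE e < edgeLen q0 e) : -loErr0 P qs q0 e < distErr qs q0 e := by
  by_cases h : 0 ≤ distErr qs q0 e
  · have := loErr0_pos (q0 := q0) hP e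
    linarith
  · have h1 := hP.mu_pos
    have h2 := neg_abs_le (distErr qs q0 e)
    rw [loErr0, if_neg h, neg_lt]
    exact lt_min (by linarith) (by unfold distErr; linarith)

theorem rho_pos (hP : P.Admissible qs) (t : ℝ) (e : G.edgeSet) : 0 < rho P t e :=
  add_pos (mul_pos (sub_pos.2 (hP.rhoInf_lt e)) (Real.exp_pos _)) (hP.rhoInf_pos e)

theorem rhoInf_le_rho (hP : P.Admissible qs) (t : ℝ) (e : G.edgeSet) : P.rhoInf e ≤ rho P t e :=
  le_add_of_nonneg_left (mul_pos (sub_pos.2 (hP.rhoInf_lt e)) (Real.exp_pos _)).le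

theorem exp_neg_mul_le_one (hP : P.Admissible qs) {t : ℝ} (ht : 0 ≤ t) (e : G.edgeSet) :
    Real.exp (-(P.a e) * t) ≤ 1 := by
  rw [Real.exp_le_one_iff]
  nlinarith [hP.a_pos e]

theorem rho_le_rho0 (hP : P.Admissible qs) {t : ℝ} (ht : 0 ≤ t) (e : G.edgeSet) :
    rho P t e ≤ P.rho0 e := by
  have h1 := exp_neg_mul_le_one hP ht e
  have h2 := hP.rhoInf_lt e
  unfold rho
  nlinarith

theorem rho_zero (e : G.edgeSet) : rho P 0 e = P.rho0 e := by
  simp [rho]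

/-- The time derivative of the performance function. -/
noncomputable def rhoDeriv (P : Params G) (t : ℝ) (e : G.edgeSet) : ℝ :=
  (P.rho0 e - P.rhoInf e) * (Real.exp (-(P.a e) * t) * -(P.a e))

theorem hasDerivAt_rho (t : ℝ) (e : G.edgeSet) :
    HasDerivAt (fun t => rho P t e) (rhoDeriv P t e) t := by
  have h1 : HasDerivAt (fun t => -(P.a e) * t) (-(P.a e)) t := by
    simpa using (hasDerivAt_id t).const_mul (-(P.a e))
  exact (h1.exp.const_mul _).add_const _

theorem abs_rhoDeriv_le (hP : P.Admissible qs) {t : ℝ} (ht : 0 ≤ t) (e : G.edgeSet) :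
    |rhoDeriv P t e| ≤ (P.rho0 e - P.rhoInf e) * P.a e := by
  have h1 := exp_neg_mul_le_one hP ht e
  have h2 := sub_pos.2 (hP.rhoInf_lt e)
  have h3 := hP.a_pos e
  rw [rhoDeriv, abs_mul, abs_mul, abs_neg, abs_of_pos h2, abs_of_pos h3, abs_of_pos (Real.exp_pos _)]
  exact mul_le_mul_of_nonneg_left (mul_le_of_le_one_left h3.le h1) h2.le

theorem rho0_pos (hP : P.Admissible qs) (e : G.edgeSet) : 0 < P.rho0 e :=
  (hP.rhoInf_pos e).trans (hP.rhoInf_lt e)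

theorem edgeLen_target_pos (hP : P.Admissible qs) (e : G.edgeSet) : 0 < edgeLen qs e :=
  (hP.rsE_pos e).trans (hP.rsE_lt e)

theorem bUp_mul_rho0 (hP : P.Admissible qs) (e : G.edgeSet) :
    bUp P qs q0 e * P.rho0 e = upErr0 P qs q0 e ^ 2 + 2 * edgeLen qs e * upErr0 P qs q0 e :=
  div_mul_cancel₀ _ (rho0_pos hP e).ne'

theorem bLo_mul_rho0 (hP : P.Admissible qs) (e : G.edgeSet) :
    bLo P qs q0 e * P.rho0 e = 2 * edgeLen qs e * loErr0 P qs q0 e - loErr0 P qs q0 e ^ 2 :=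
  div_mul_cancel₀ _ (rho0_pos hP e).ne'

theorem bUp_pos (hP : P.Admissible qs) (e : G.edgeSet) : 0 < bUp P qs q0 e := by
  have h1 := upErr0_pos (q0 := q0) hP e
  have h2 := edgeLen_target_pos hP e
  exact div_pos (by positivity) (rho0_pos hP e)

theorem bLo_pos (hP : P.Admissible qs) (e : G.edgeSet) : 0 < bLo P qs q0 e := by
  have h1 := loErr0_pos (q0 := q0) hP e
  have h2 := loErr0_lt_edgeLen (q0 := q0) hP e
  exact div_pos (by nlinarith) (rho0_pos hP e)

/-- The prescribed bounds on the squared distance error. -/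
def PrescribedAt (P : Params G) (qs q0 : Config n m) (t : ℝ) (p : Config n m) (e : G.edgeSet) :
    Prop :=
  -(bLo P qs q0 e * rho P t e) < sqErr qs p e ∧ sqErr qs p e < bUp P qs q0 e * rho P t e

theorem prescribedAt_zero (hP : P.Admissible qs) {e : G.edgeSet}
    (h0 : P.rsE e < edgeLen q0 e ∧ edgeLen q0 e < P.rcE e) : PrescribedAt P qs q0 0 q0 e := by
  have h1 := distErr_lt_upErr0 hP h0.2
  have h2 := neg_loErr0_lt_distErr hP h0.1
  have h3 := loErr0_lt_edgeLen (q0 := q0) hP e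
  have h4 := edgeLen_target_pos hP e
  have h5 := upErr0_pos (q0 := q0) hP e
  have h6 : 0 < edgeLen q0 e := (hP.rsE_pos e).trans h0.1
  rw [PrescribedAt, rho_zero, bUp_mul_rho0 hP, bLo_mul_rho0 hP]
  unfold distErr at h1 h2
  unfold sqErr
  constructor <;> nlinarith

theorem PrescribedAt.distErr_bounds (hP : P.Admissible qs) {t : ℝ} (ht : 0 ≤ t) {p : Config n m}
    {e : G.edgeSet} (h : PrescribedAt P qs q0 t p e) :
    -loErr0 P qs q0 e < distErr qs p e ∧ distErr qs p e < upErr0 P qs q0 e := by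
  have hr := rho_le_rho0 hP ht e
  have h1 := mul_le_mul_of_nonneg_left hr (bUp_pos (q0 := q0) hP e).le
  have h2 := mul_le_mul_of_nonneg_left hr (bLo_pos (q0 := q0) hP e).le
  rw [bUp_mul_rho0 hP] at h1
  rw [bLo_mul_rho0 hP] at h2
  have h3 := loErr0_lt_edgeLen (q0 := q0) hP e
  have h4 := edgeLen_target_pos hP e
  have h5 := upErr0_pos (q0 := q0) hP e
  have h6 : 0 ≤ edgeLen p e := norm_nonneg _
  obtain ⟨h7, h8⟩ := h
  unfold sqErr at h7 h8
  unfold distErr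
  constructor
  · have : edgeLen qs e - loErr0 P qs q0 e < edgeLen p e :=
      lt_of_pow_lt_pow_left₀ 2 h6 (by nlinarith)
    linarith
  · have : edgeLen p e < edgeLen qs e + upErr0 P qs q0 e :=
      lt_of_pow_lt_pow_left₀ 2 (by linarith) (by nlinarith)
    linarith

theorem sum_abs_distErr_le [Fintype G.edgeSet] (hP : P.Admissible qs) {ϑ t : ℝ} (ht : 0 ≤ t)
    {p : Config n m} (hΩ : InOmegaI P qs q0 ϑ) (h : ∀ e, PrescribedAt P qs q0 t p e) :
    ∑ e : G.edgeSet, |distErr qs p e| ≤ ϑ := by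
  refine (Finset.sum_le_sum fun e _ => ?_).trans hΩ
  obtain ⟨h1, h2⟩ := (h e).distErr_bounds hP ht
  rw [abs_le]
  have h3 := le_abs_self (loErr0 P qs q0 e)
  have h4 := le_abs_self (upErr0 P qs q0 e)
  have h5 := le_max_left |loErr0 P qs q0 e| |upErr0 P qs q0 e|
  have h6 := le_max_right |loErr0 P qs q0 e| |upErr0 P qs q0 e|
  constructor <;> linarith

end InitialBounds

/-! ### The transformed error as a function of the modulated error -/

/-- The error transformation with bounds `-b < x < a`. -/
noncomputable def transErr (a b x : ℝ) : ℝ := 1 / 2 * Real.log ((a * x + a * b) / (a * b - b * x))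

/-- The slope of the error transformation, up to the factor `1 / 2`. -/
noncomputable def transGain (a b x : ℝ) : ℝ := 1 / (x + b) - 1 / (x - a)

variable {a b x : ℝ}

theorem hasDerivAt_transErr (ha : 0 < a) (hb : 0 < b) (h1 : -b < x) (h2 : x < a) :
    HasDerivAt (transErr a b) (1 / 2 * transGain a b x) x := by
  have hn : 0 < a * x + a * b := by nlinarith
  have hd : 0 < a * b - b * x := by nlinarith
  have e1 : HasDerivAt (fun x => a * x + a * b) a x := by
    simpa using ((hasDerivAt_id x).const_mul a).add_const (a * b)
  have e2 : HasDerivAt (fun x => a * b - b * x) (-b) x := by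
    simpa using ((hasDerivAt_id x).const_mul b).const_sub (a * b)
  have e3 := ((e1.div e2 hd.ne').log (div_pos hn hd).ne').const_mul (1 / 2)
  refine e3.congr_deriv ?_
  have h3 : x + b ≠ 0 := by linarith
  have h4 : x - a ≠ 0 := by linarith
  have h4' : a - x ≠ 0 := by linarith
  simp only [Pi.div_apply, transGain]
  have h5 : a * x + a * b = a * (x + b) := by ring
  have h6 : a * b - b * x = b * (a - x) := by ring
  rw [h5, h6]
  have h7 : x - a = -(a - x) := by ring
  rw [h7]
  field_simp

theorem contDiffAt_transErr (ha : 0 < a) (hb : 0 < b) (h1 : -b < x) (h2 : x < a) :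
    ContDiffAt ℝ 1 (transErr a b) x := by
  have hn : 0 < a * x + a * b := by nlinarith
  have hd : 0 < a * b - b * x := by nlinarith
  unfold transErr
  exact contDiffAt_const.mul (((by fun_prop : ContDiffAt ℝ 1 (fun x => a * x + a * b) x).div
    (by fun_prop) hd.ne').log (div_pos hn hd).ne')

theorem contDiffAt_transGain (h1 : -b < x) (h2 : x < a) : ContDiffAt ℝ 1 (transGain a b) x := by
  unfold transGain
  exact (contDiffAt_const.div (by fun_prop) (by linarith)).sub
    (contDiffAt_const.div (by fun_prop) (by linarith))

/-- Both reciprocal distances to the endpoints contribute positively, and one already exceeds the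
reciprocal of the interval length. This bounds `ξ` below, so the edge forces control `σ`. -/
theorem inv_add_le_transGain (h1 : -b < x) (h2 : x < a) :
    1 / (a + b) ≤ transGain a b x := by
  have h3 : 1 / (a + b) ≤ 1 / (x + b) := one_div_le_one_div_of_le (by linarith) (by linarith)
  have h4 : 1 / (x - a) < 0 := one_div_neg.2 (by linarith)
  unfold transGain
  linarith

theorem abs_transGain_le {ε : ℝ} (hε : 0 < ε) (h1 : ε ≤ x + b) (h2 : ε ≤ a - x) :
    |transGain a b x| ≤ 2 / ε := by
  have h3 : 1 / (x + b) ≤ 1 / ε := one_div_le_one_div_of_le hε h1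
  have h4 : 1 / (a - x) ≤ 1 / ε := one_div_le_one_div_of_le hε h2
  have h5 : 0 < 1 / (x + b) := one_div_pos.2 (by linarith)
  have h6 : 0 < 1 / (a - x) := one_div_pos.2 (by linarith)
  have h7 : transGain a b x = 1 / (x + b) + 1 / (a - x) := by
    rw [transGain, ← neg_sub a x, one_div_neg_eq_neg_one_div]; ring
  have h8 : 2 / ε = 1 / ε + 1 / ε := by ring
  rw [h7, abs_of_pos (by linarith), h8]
  linarith

/-- A bound on the transformed error keeps the modulated error away from the bounds. -/
theorem exists_margin_of_transErr_sq_le (ha : 0 < a) (hb : 0 < b) (B : ℝ) :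
    ∃ ε : ℝ, 0 < ε ∧ ∀ x, -b < x → x < a → transErr a b x ^ 2 ≤ B → ε ≤ x + b ∧ ε ≤ a - x := by
  set Λ := Real.exp (2 * √B) with hΛ
  have hΛ0 : 0 < Λ := Real.exp_pos _
  -- The bound on `transErr` confines the ratio in the logarithm to `[Λ⁻¹, Λ]`; these are the
  -- distances from `x` to `-b` and to `a` when the ratio equals `Λ⁻¹` and `Λ`.
  refine ⟨min (b * (a + b) / (Λ * a + b)) (a * (a + b) / (Λ * b + a)), by positivity,
    fun x h1 h2 h => ?_⟩
  have hn : 0 < a * x + a * b := by nlinarith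
  have hd : 0 < a * b - b * x := by nlinarith
  have hr : 0 < (a * x + a * b) / (a * b - b * x) := div_pos hn hd
  have habs := Real.abs_le_sqrt h
  rw [transErr, abs_le] at habs
  have hup : (a * x + a * b) / (a * b - b * x) ≤ Λ := by
    rw [hΛ, ← Real.log_le_iff_le_exp hr]
    linarith [habs.2]
  have hlo : ((a * x + a * b) / (a * b - b * x))⁻¹ ≤ Λ := by
    rw [hΛ, ← Real.log_le_iff_le_exp (inv_pos.2 hr), Real.log_inv]
    linarith [habs.1]
  rw [div_le_iff₀ hd] at hup
  rw [inv_div, div_le_iff₀ hn] at hlo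
  constructor
  · refine (min_le_left _ _).trans ?_
    rw [div_le_iff₀ (by positivity)]
    nlinarith
  · refine (min_le_right _ _).trans ?_
    rw [div_le_iff₀ (by positivity)]
    nlinarith


/-! ### The closed loop in terms of edge vectors -/

variable {n m : ℕ} {G : SimpleGraph (Fin n)}

/-- The modulated errors as functions of time and edge vectors. -/
noncomputable def errOf (P : Params G) (qs : Config n m)
    (x : ℝ × (G.edgeSet → EuclideanSpace ℝ (Fin m))) (e : G.edgeSet) : ℝ :=
  (‖x.2 e‖ ^ 2 - edgeLen qs e ^ 2) / rho P x.1 e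

/-- The transformed errors as functions of time and edge vectors. -/
noncomputable def transErrOf (P : Params G) (qs q0 : Config n m)
    (x : ℝ × (G.edgeSet → EuclideanSpace ℝ (Fin m))) (e : G.edgeSet) : ℝ :=
  transErr (bUp P qs q0 e) (bLo P qs q0 e) (errOf P qs x e)

/-- The gains `ξ` as functions of time and edge vectors. -/
noncomputable def gainOf (P : Params G) (qs q0 : Config n m)
    (x : ℝ × (G.edgeSet → EuclideanSpace ℝ (Fin m))) (e : G.edgeSet) : ℝ :=
  1 / rho P x.1 e * transGain (bUp P qs q0 e) (bLo P qs q0 e) (errOf P qs x e)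

/-- The edge forces `ξ K σ`. -/
noncomputable def edgeForce (P : Params G) (qs q0 : Config n m)
    (x : ℝ × (G.edgeSet → EuclideanSpace ℝ (Fin m))) (e : G.edgeSet) : ℝ :=
  gainOf P qs q0 x e * P.k e * transErrOf P qs q0 x e

/-- The region where all prescribed bounds hold. -/
def boundedRegion (P : Params G) (qs q0 : Config n m) :
    Set (ℝ × (G.edgeSet → EuclideanSpace ℝ (Fin m))) :=
  {x | ∀ e, -bLo P qs q0 e < errOf P qs x e ∧ errOf P qs x e < bUp P qs q0 e}

variable {P : Params G} {qs q0 : Config n m}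

theorem contDiff_errOf (hP : P.Admissible qs) (e : G.edgeSet) [Fintype G.edgeSet] :
    ContDiff ℝ 1 (fun x => errOf P qs x e) := by
  have h1 : ContDiff ℝ 1 (fun x : ℝ × (G.edgeSet → EuclideanSpace ℝ (Fin m)) =>
      ‖x.2 e‖ ^ 2 - edgeLen qs e ^ 2) :=
    (ContDiff.norm_sq ℝ (by fun_prop)).sub contDiff_const
  have h2 : ContDiff ℝ 1 (fun x : ℝ × (G.edgeSet → EuclideanSpace ℝ (Fin m)) => rho P x.1 e) := by
    unfold rho
    fun_prop
  exact h1.div h2 fun x => (rho_pos hP x.1 e).ne'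

theorem abs_errOf_le {x : ℝ × (G.edgeSet → EuclideanSpace ℝ (Fin m))}
    (hP : P.Admissible qs) (hx : x ∈ boundedRegion P qs q0) (e : G.edgeSet) :
    |errOf P qs x e| ≤ bUp P qs q0 e + bLo P qs q0 e := by
  have h1 := bUp_pos (q0 := q0) hP e
  have h2 := bLo_pos (q0 := q0) hP e
  rw [abs_le]
  constructor <;> linarith [(hx e).1, (hx e).2]

theorem norm_edge_sq_le (hP : P.Admissible qs) {x : ℝ × (G.edgeSet → EuclideanSpace ℝ (Fin m))}
    (hx : x ∈ boundedRegion P qs q0) (ht : 0 ≤ x.1) (e : G.edgeSet) :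
    ‖x.2 e‖ ^ 2 ≤ edgeLen qs e ^ 2 + bUp P qs q0 e * P.rho0 e := by
  have h1 := (hx e).2
  rw [errOf, div_lt_iff₀ (rho_pos hP x.1 e)] at h1
  have h2 := mul_le_mul_of_nonneg_left (rho_le_rho0 hP ht e) (bUp_pos (q0 := q0) hP e).le
  linarith

theorem exists_norm_edge_le [Finite G.edgeSet] (hP : P.Admissible qs) : ∃ C : ℝ, 0 ≤ C ∧
    ∀ x ∈ boundedRegion P qs q0, 0 ≤ x.1 → ∀ e, ‖x.2 e‖ ≤ C := by
  obtain ⟨C, hC⟩ := exists_forall_le fun e : G.edgeSet =>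
    √(edgeLen qs e ^ 2 + bUp P qs q0 e * P.rho0 e)
  refine ⟨max C 0, le_max_right _ _, fun x hx ht e => ?_⟩
  exact (Real.le_sqrt_of_sq_le (norm_edge_sq_le hP hx ht e)).trans ((hC e).trans (le_max_left _ _))

variable [Fintype G.edgeSet]

/-- The control law as a function of time and edge vectors. -/
noncomputable def feedback (P : Params G) (qs q0 : Config n m)
    (x : ℝ × (G.edgeSet → EuclideanSpace ℝ (Fin m))) : Config n m :=
  -stressForce x.2 (edgeForce P qs q0 x)

/-- The barrier function `∑ k σ²`. -/
noncomputable def barrier (P : Params G) (qs q0 : Config n m)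
    (x : ℝ × (G.edgeSet → EuclideanSpace ℝ (Fin m))) : ℝ :=
  ∑ e, P.k e * transErrOf P qs q0 x e ^ 2

theorem xi_eq_gainOf (t : ℝ) (p : Config n m) (e : G.edgeSet) :
    xi P qs q0 t p e = gainOf P qs q0 (t, edgeVecL n m G p) e := rfl

/-- The input depends on the configuration only through its edge vectors, so compactness in edge
space suffices. -/
theorem controlLaw_eq_feedback (t : ℝ) (p : Config n m) :
    controlLaw P qs q0 t p = feedback P qs q0 (t, edgeVecL n m G p) := by
  funext i
  ext c
  have h : (-((rigidityMatrix G p).transpose * Matrix.diagonal (xi P qs q0 t p) *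
      Matrix.diagonal P.k).mulVec (sigma P qs q0 t p))
      = -(rigidityMatrix G p).transpose.mulVec (edgeForce P qs q0 (t, edgeVecL n m G p)) := by
    rw [← Matrix.mulVec_mulVec, ← Matrix.mulVec_mulVec]
    congr 2
    funext e
    rw [Matrix.mulVec_diagonal, Matrix.mulVec_diagonal, edgeForce, mul_assoc]
    rfl
  rw [feedback, Pi.neg_apply, PiLp.neg_apply, ← transpose_mulVec_apply]
  exact congrFun h (i, c)

theorem prescribedAt_iff (hP : P.Admissible qs) (t : ℝ) (p : Config n m) (e : G.edgeSet) :
    PrescribedAt P qs q0 t p e ↔ -bLo P qs q0 e < errOf P qs (t, edgeVecL n m G p) e ∧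
      errOf P qs (t, edgeVecL n m G p) e < bUp P qs q0 e := by
  have h := rho_pos hP t e
  have : errOf P qs (t, edgeVecL n m G p) e = sqErr qs p e / rho P t e := rfl
  rw [this, lt_div_iff₀ h, div_lt_iff₀ h, neg_mul]
  rfl

theorem isOpen_boundedRegion (hP : P.Admissible qs) : IsOpen (boundedRegion P qs q0) := by
  have : boundedRegion P qs q0 = ⋂ e, {x | -bLo P qs q0 e < errOf P qs x e} ∩
      {x | errOf P qs x e < bUp P qs q0 e} := by
    ext x
    simp [boundedRegion]
  rw [this]
  exact isOpen_iInter_of_finite fun e =>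
    (isOpen_lt continuous_const (contDiff_errOf hP e).continuous).inter
      (isOpen_lt (contDiff_errOf hP e).continuous continuous_const)

theorem contDiffAt_transErrOf (hP : P.Admissible qs)
    {x : ℝ × (G.edgeSet → EuclideanSpace ℝ (Fin m))} (hx : x ∈ boundedRegion P qs q0)
    (e : G.edgeSet) : ContDiffAt ℝ 1 (fun x => transErrOf P qs q0 x e) x :=
  (contDiffAt_transErr (bUp_pos hP e) (bLo_pos hP e) (hx e).1 (hx e).2).comp x
    (contDiff_errOf hP e).contDiffAt

theorem contDiffAt_edgeForce (hP : P.Admissible qs)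
    {x : ℝ × (G.edgeSet → EuclideanSpace ℝ (Fin m))} (hx : x ∈ boundedRegion P qs q0)
    (e : G.edgeSet) : ContDiffAt ℝ 1 (fun x => edgeForce P qs q0 x e) x := by
  have h1 : ContDiffAt ℝ 1
      (fun x => transGain (bUp P qs q0 e) (bLo P qs q0 e) (errOf P qs x e)) x :=
    (contDiffAt_transGain (hx e).1 (hx e).2).comp
      (f := fun x => errOf P qs x e) x (contDiff_errOf hP e).contDiffAt
  have h2 : ContDiff ℝ 1 (fun x : ℝ × (G.edgeSet → EuclideanSpace ℝ (Fin m)) => rho P x.1 e) := by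
    unfold rho
    fun_prop
  exact (((contDiffAt_const.div h2.contDiffAt (rho_pos hP x.1 e).ne').mul h1).mul
    contDiffAt_const).mul (contDiffAt_transErrOf hP hx e)

theorem contDiffOn_feedback (hP : P.Admissible qs) :
    ContDiffOn ℝ 1 (feedback P qs q0) (boundedRegion P qs q0) := by
  intro x hx
  refine ContDiffAt.contDiffWithinAt ?_
  refine ContDiffAt.neg (contDiffAt_pi.2 fun i => ?_)
  refine ContDiffAt.sum fun e _ => ?_
  exact ((contDiffAt_edgeForce hP hx e).mul contDiffAt_const).smul (by fun_prop)

theorem contDiffAt_barrier (hP : P.Admissible qs)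
    {x : ℝ × (G.edgeSet → EuclideanSpace ℝ (Fin m))} (hx : x ∈ boundedRegion P qs q0) :
    ContDiffAt ℝ 1 (barrier P qs q0) x :=
  ContDiffAt.sum fun e _ => contDiffAt_const.mul ((contDiffAt_transErrOf hP hx e).pow 2)

/-! ### Sublevel sets of the barrier function -/

/-- The part of the region on which the barrier function is at most `M`. -/
def sublevel (P : Params G) (qs q0 : Config n m) (M : ℝ) :
    Set (ℝ × (G.edgeSet → EuclideanSpace ℝ (Fin m))) :=
  {x | x ∈ boundedRegion P qs q0 ∧ barrier P qs q0 x ≤ M}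

theorem transErrOf_sq_le (hP : P.Admissible qs) {M : ℝ}
    {x : ℝ × (G.edgeSet → EuclideanSpace ℝ (Fin m))} (hx : x ∈ sublevel P qs q0 M)
    (e : G.edgeSet) : transErrOf P qs q0 x e ^ 2 ≤ M / P.k e := by
  rw [le_div_iff₀' (hP.k_pos e)]
  refine le_trans ?_ hx.2
  exact Finset.single_le_sum (f := fun e => P.k e * transErrOf P qs q0 x e ^ 2)
    (fun e _ => mul_nonneg (hP.k_pos e).le (sq_nonneg _)) (Finset.mem_univ e)

theorem exists_margin (hP : P.Admissible qs) (M : ℝ) :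
    ∃ ε : ℝ, 0 < ε ∧ ∀ x ∈ sublevel P qs q0 M, ∀ e,
      ε ≤ errOf P qs x e + bLo P qs q0 e ∧ ε ≤ bUp P qs q0 e - errOf P qs x e := by
  choose ε hε h using fun e : G.edgeSet =>
    exists_margin_of_transErr_sq_le (bUp_pos (q0 := q0) hP e) (bLo_pos (q0 := q0) hP e) (M / P.k e)
  obtain ⟨c, hc, hcε⟩ := exists_pos_forall_le ε hε
  refine ⟨c, hc, fun x hx e => ?_⟩
  obtain ⟨h1, h2⟩ := h e _ (hx.1 e).1 (hx.1 e).2 (transErrOf_sq_le hP hx e)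
  exact ⟨(hcε e).trans h1, (hcε e).trans h2⟩

/-- The region itself is open; the uniform margin places the sublevel set inside a closed subset of
it, on which the barrier is continuous. -/
theorem isClosed_sublevel (hP : P.Admissible qs) (M : ℝ) : IsClosed (sublevel P qs q0 M) := by
  obtain ⟨ε, hε, h⟩ := exists_margin (q0 := q0) hP M
  let S : Set (ℝ × (G.edgeSet → EuclideanSpace ℝ (Fin m))) := ⋂ e,
    {x | ε ≤ errOf P qs x e + bLo P qs q0 e} ∩ {x | ε ≤ bUp P qs q0 e - errOf P qs x e}
  have hS : IsClosed S := isClosed_iInter fun e =>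
    (isClosed_le continuous_const ((contDiff_errOf hP e).continuous.add continuous_const)).inter
      (isClosed_le continuous_const (continuous_const.sub (contDiff_errOf hP e).continuous))
  have hSU : S ⊆ boundedRegion P qs q0 := by
    intro x hx e
    obtain ⟨h1, h2⟩ := mem_iInter.1 hx e
    have h1' : ε ≤ errOf P qs x e + bLo P qs q0 e := h1
    have h2' : ε ≤ bUp P qs q0 e - errOf P qs x e := h2
    constructor <;> linarith
  have hc : ContinuousOn (barrier P qs q0) S := fun x hx =>
    (contDiffAt_barrier hP (hSU hx)).continuousAt.continuousWithinAt
  have heq : sublevel P qs q0 M = S ∩ barrier P qs q0 ⁻¹' Iic M := by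
    ext x
    exact ⟨fun hx => ⟨mem_iInter.2 fun e => h x hx e, hx.2⟩, fun hx => ⟨hSU hx.1, hx.2⟩⟩
  rw [heq]
  exact hc.preimage_isClosed_of_isClosed hS isClosed_Iic

theorem isCompact_sublevel (hP : P.Admissible qs) (M T : ℝ) :
    IsCompact (sublevel P qs q0 M ∩ Icc 0 T ×ˢ univ) := by
  obtain ⟨C, hC0, hC⟩ := exists_norm_edge_le (q0 := q0) hP
  refine Metric.isCompact_of_isClosed_isBounded
    ((isClosed_sublevel hP M).inter (isClosed_Icc.prod isClosed_univ)) ?_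
  refine ((Metric.isBounded_Icc 0 T).prod (Metric.isBounded_closedBall (x := 0) (r := C))).subset ?_
  rintro x ⟨hx, ht, -⟩
  refine ⟨ht, ?_⟩
  rw [mem_closedBall_zero_iff, pi_norm_le_iff_of_nonneg hC0]
  exact hC x hx.1 ht.1

/-- The margin `ε` and the bounds `ρ_∞ ≤ ρ(t) ≤ ρ₀` do not depend on `t`, so one constant serves all
times. -/
theorem exists_signal_bounds (hP : P.Admissible qs) (M : ℝ) :
    ∃ C : ℝ, ∀ (t : ℝ) (p : Config n m), 0 ≤ t → (t, edgeVecL n m G p) ∈ sublevel P qs q0 M →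
      (∀ e : G.edgeSet, edgeLen p e ≤ C ∧ |distErr qs p e| ≤ C ∧ |sqErr qs p e| ≤ C ∧
        |modErr P qs t p e| ≤ C ∧ |sigma P qs q0 t p e| ≤ C ∧ |xi P qs q0 t p e| ≤ C) ∧
      ∀ i, ‖controlLaw P qs q0 t p i‖ ≤ C := by
  obtain ⟨C₁, hC₁0, hC₁⟩ := exists_norm_edge_le (q0 := q0) hP
  obtain ⟨C₂, hC₂⟩ := exists_forall_le fun e : G.edgeSet => edgeLen qs e
  obtain ⟨C₃, hC₃⟩ := exists_forall_le fun e : G.edgeSet => bUp P qs q0 e + bLo P qs q0 e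
  obtain ⟨C₄, hC₄⟩ := exists_forall_le fun e : G.edgeSet => √(M / P.k e)
  obtain ⟨ε, hε, hmargin⟩ := exists_margin (q0 := q0) hP M
  obtain ⟨C₅, hC₅⟩ := exists_forall_le fun e : G.edgeSet => 1 / P.rhoInf e * (2 / ε)
  let F : ℝ := ∑ e : G.edgeSet, |C₅| * P.k e * |C₄| * C₁
  have hF : 0 ≤ F := Finset.sum_nonneg fun e _ => by
    have := hP.k_pos e
    positivity
  refine ⟨C₁ + |C₂| + (C₁ ^ 2 + C₂ ^ 2) + |C₃| + |C₄| + |C₅| + F, fun t p ht hx => ?_⟩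
  have a2 := abs_nonneg C₂
  have a3 := abs_nonneg C₃
  have a4 := abs_nonneg C₄
  have a5 := abs_nonneg C₅
  have s1 := sq_nonneg C₁
  have s2 := sq_nonneg C₂
  have hlen : ∀ e : G.edgeSet, edgeLen p e ≤ C₁ := fun e => hC₁ _ hx.1 ht e
  have hpos : ∀ (r : Config n m) (e : G.edgeSet), 0 ≤ edgeLen r e := fun r e => norm_nonneg _
  have hmod : ∀ e : G.edgeSet, |modErr P qs t p e| ≤ C₃ := fun e =>
    (abs_errOf_le hP hx.1 e).trans (hC₃ e)
  have hsig : ∀ e : G.edgeSet, |sigma P qs q0 t p e| ≤ C₄ := fun e =>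
    (Real.abs_le_sqrt (transErrOf_sq_le hP hx e)).trans (hC₄ e)
  have hxi : ∀ e : G.edgeSet, |xi P qs q0 t p e| ≤ C₅ := by
    intro e
    refine le_trans ?_ (hC₅ e)
    rw [xi_eq_gainOf, gainOf, abs_mul, abs_of_pos (one_div_pos.2 (rho_pos hP _ e))]
    exact mul_le_mul (one_div_le_one_div_of_le (hP.rhoInf_pos e) (rhoInf_le_rho hP t e))
      (abs_transGain_le hε (hmargin _ hx e).1 (hmargin _ hx e).2) (abs_nonneg _)
      (one_div_pos.2 (hP.rhoInf_pos e)).le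
  refine ⟨fun e => ⟨?_, ?_, ?_, ?_, ?_, ?_⟩, fun i => ?_⟩
  · linarith [hlen e]
  · have h1 := hlen e
    have h2 := (hC₂ e).trans (le_abs_self _)
    have h3 := hpos p e
    have h4 := hpos qs e
    rw [distErr, abs_le]
    constructor <;> linarith
  · have h1 := pow_le_pow_left₀ (hpos p e) (hlen e) 2
    have h2 := pow_le_pow_left₀ (hpos qs e) (hC₂ e) 2
    have h3 := sq_nonneg (edgeLen p e)
    have h4 := sq_nonneg (edgeLen qs e)
    rw [sqErr, abs_le]
    constructor <;> linarith
  · linarith [hmod e, le_abs_self C₃]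
  · linarith [hsig e, le_abs_self C₄]
  · linarith [hxi e, le_abs_self C₅]
  · have : ‖controlLaw P qs q0 t p i‖ ≤ F := by
      rw [controlLaw_eq_feedback, feedback, Pi.neg_apply, norm_neg]
      refine norm_sum_le_of_le _ fun e _ => ?_
      have hinc : |inc e i| ≤ 1 := by
        unfold inc
        split_ifs <;> simp
      have hk := hP.k_pos e
      rw [norm_smul, Real.norm_eq_abs, abs_mul, edgeForce, abs_mul, abs_mul, abs_of_pos hk]
      have h1 : |gainOf P qs q0 (t, edgeVecL n m G p) e| ≤ |C₅| := (hxi e).trans (le_abs_self _)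
      have h2 : |transErrOf P qs q0 (t, edgeVecL n m G p) e| ≤ |C₄| :=
        (hsig e).trans (le_abs_self _)
      have h3 : ‖edgeVecL n m G p e‖ ≤ C₁ := hlen e
      have h4 : |gainOf P qs q0 (t, edgeVecL n m G p) e| * P.k e *
          |transErrOf P qs q0 (t, edgeVecL n m G p) e| * |inc e i| ≤ |C₅| * P.k e * |C₄| :=
        (mul_le_of_le_one_right (by positivity) hinc).trans (by gcongr)
      exact mul_le_mul h4 h3 (norm_nonneg _) (by positivity)
    linarith

/-! ### Decay of the barrier function -/

/-- The time derivative of the barrier function along a motion with velocity `v`. -/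
noncomputable def barrierDeriv (P : Params G) (qs q0 : Config n m) (t : ℝ) (p v : Config n m) : ℝ :=
  ∑ e : G.edgeSet, edgeForce P qs q0 (t, edgeVecL n m G p) e *
    (2 * inner ℝ (edgeVec p e) (edgeVec v e) -
      rhoDeriv P t e * errOf P qs (t, edgeVecL n m G p) e)

/-- The factor `1 / 2` in `σ` cancels the `2` from differentiating `σ²`, so the coefficient on each
edge is exactly the edge force used by the controller. -/
theorem hasDerivWithinAt_barrier (hP : P.Admissible qs) {q : ℝ → Config n m} {v : Config n m}
    {s : Set ℝ} {t : ℝ} (hq : HasDerivWithinAt q v s t)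
    (hx : (t, edgeVecL n m G (q t)) ∈ boundedRegion P qs q0) :
    HasDerivWithinAt (fun r => barrier P qs q0 (r, edgeVecL n m G (q r)))
      (barrierDeriv P qs q0 t (q t) v) s t := by
  refine HasDerivWithinAt.fun_sum fun e _ => ?_
  have hρ := rho_pos hP t e
  have h1 : HasDerivWithinAt (fun r => edgeVec (q r) e) (edgeVec v e) s t :=
    (hasDerivWithinAt_pi.1 hq _).sub (hasDerivWithinAt_pi.1 hq _)
  have h2 : HasDerivWithinAt (fun r => errOf P qs (r, edgeVecL n m G (q r)) e)
      ((2 * inner ℝ (edgeVec (q t) e) (edgeVec v e) -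
        rhoDeriv P t e * errOf P qs (t, edgeVecL n m G (q t)) e) / rho P t e) s t := by
    have h3 := (h1.norm_sq.sub_const (edgeLen qs e ^ 2)).div
      (hasDerivAt_rho (P := P) t e).hasDerivWithinAt hρ.ne'
    refine h3.congr_deriv ?_
    simp only [errOf, edgeVecL_apply]
    field_simp
  have h4 := ((((hasDerivAt_transErr (bUp_pos hP e) (bLo_pos hP e) (hx e).1
    (hx e).2).comp_hasDerivWithinAt t h2).pow 2).const_mul (P.k e))
  refine h4.congr_deriv ?_
  simp only [edgeForce, gainOf, transErrOf, Function.comp_apply]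
  field_simp
  ring

theorem barrierDeriv_neg_of_large {ϑ lam D : ℝ} (hP : P.Admissible qs) (hlam : 0 < lam)
    (hrig : ∀ p : Config n m, ∑ e : G.edgeSet, |distErr qs p e| ≤ ϑ → ∀ z : G.edgeSet → ℝ,
      lam * ∑ e, z e ^ 2 ≤ ∑ i, ‖stressForce (edgeVecL n m G p) z i‖ ^ 2)
    (hΩ : InOmegaI P qs q0 ϑ) :
    ∃ M₀ : ℝ, ∀ (t : ℝ) (p l : Config n m), 0 ≤ t →
      (t, edgeVecL n m G p) ∈ boundedRegion P qs q0 → (∀ i, ‖l i‖ ≤ D) →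
      M₀ < barrier P qs q0 (t, edgeVecL n m G p) →
      barrierDeriv P qs q0 t p (feedback P qs q0 (t, edgeVecL n m G p) + l) < 0 := by
  obtain ⟨C, hC⟩ := exists_forall_le fun e : G.edgeSet =>
    (P.rho0 e - P.rhoInf e) * P.a e * (bUp P qs q0 e + bLo P qs q0 e)
  -- `κ` bounds `ξ² k` below, which yields `κ V ≤ |z|²`.
  obtain ⟨κ, hκ, hκle⟩ := exists_pos_forall_le
    (fun e : G.edgeSet => (1 / P.rho0 e * (1 / (bUp P qs q0 e + bLo P qs q0 e))) ^ 2 * P.k e)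
    (fun e => by
      have h1 := rho0_pos hP e
      have h2 := bUp_pos (q0 := q0) hP e
      have h3 := bLo_pos (q0 := q0) hP e
      have h4 := hP.k_pos e
      positivity)
  -- The remainders of two applications of Young's inequality: the disturbance uses up half of `2
  -- ‖Rᵀ z‖²`, the `ρ'` term uses `λ / 2 * |z|²`. What remains is `V' ≤ -(λ / 2) |z|² + B`.
  set B : ℝ := n * D ^ 2 + Fintype.card G.edgeSet * (C ^ 2 / (2 * lam))
  refine ⟨B / (lam / 2 * κ), fun t p l ht hx hl hV => ?_⟩
  set x := (t, edgeVecL n m G p) with hxdef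
  set z := edgeForce P qs q0 x with hz
  set Φ := stressForce (edgeVecL n m G p) z with hΦ
  have hsum : ∑ e : G.edgeSet, |distErr qs p e| ≤ ϑ :=
    sum_abs_distErr_le hP ht hΩ fun e => (prescribedAt_iff hP t p e).2 (hx e)
  have h1 := hrig p hsum z
  have h2 : ∑ e, z e * inner ℝ (edgeVec p e) (edgeVec (feedback P qs q0 x + l) e)
      = -∑ i, ‖Φ i‖ ^ 2 + ∑ i, inner ℝ (Φ i) (l i) := by
    have := sum_inner_stressForce (edgeVecL n m G p) z (feedback P qs q0 x + l)
    simp only [edgeVecL_apply] at this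
    rw [← this, ← Finset.sum_neg_distrib, ← Finset.sum_add_distrib]
    refine Finset.sum_congr rfl fun i _ => ?_
    rw [Pi.add_apply, inner_add_right, feedback, Pi.neg_apply, inner_neg_right]
    have : stressForce x.2 (edgeForce P qs q0 x) i = Φ i := rfl
    rw [this, real_inner_self_eq_norm_sq]
  have h3 : ∑ i, inner ℝ (Φ i) (l i) ≤ ∑ i, (‖Φ i‖ ^ 2 / 2 + D ^ 2 / 2) := by
    refine Finset.sum_le_sum fun i _ => ?_
    have h4 := real_inner_le_norm (Φ i) (l i)
    have h5 := mul_le_mul_of_nonneg_left (hl i) (norm_nonneg (Φ i))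
    nlinarith [sq_nonneg (‖Φ i‖ - D)]
  have h6 : -∑ e, z e * (rhoDeriv P t e * errOf P qs x e)
      ≤ ∑ e, (lam / 2 * z e ^ 2 + C ^ 2 / (2 * lam)) := by
    rw [← Finset.sum_neg_distrib]
    refine Finset.sum_le_sum fun e _ => ?_
    have h7 : |rhoDeriv P t e * errOf P qs x e| ≤ C := by
      rw [abs_mul]
      refine le_trans ?_ (hC e)
      exact mul_le_mul (abs_rhoDeriv_le hP ht e) (abs_errOf_le hP hx e) (abs_nonneg _)
        ((abs_nonneg _).trans (abs_rhoDeriv_le hP ht e))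
    have h8 : -(z e * (rhoDeriv P t e * errOf P qs x e)) ≤ |z e| * C := by
      refine (neg_le_abs _).trans ?_
      rw [abs_mul]
      exact mul_le_mul_of_nonneg_left h7 (abs_nonneg _)
    refine h8.trans ?_
    have h9 : lam / 2 * z e ^ 2 + C ^ 2 / (2 * lam) - |z e| * C
        = (lam * |z e| - C) ^ 2 / (2 * lam) := by
      rw [← sq_abs (z e)]
      field_simp
      ring
    have h10 : 0 ≤ (lam * |z e| - C) ^ 2 / (2 * lam) := by positivity
    linarith
  have h11 : κ * barrier P qs q0 x ≤ ∑ e, z e ^ 2 := by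
    rw [barrier, Finset.mul_sum]
    refine Finset.sum_le_sum fun e _ => ?_
    have hk := hP.k_pos e
    have hg : 1 / P.rho0 e * (1 / (bUp P qs q0 e + bLo P qs q0 e)) ≤ gainOf P qs q0 x e := by
      have b1 := bUp_pos (q0 := q0) hP e
      have b2 := bLo_pos (q0 := q0) hP e
      exact mul_le_mul (one_div_le_one_div_of_le (rho_pos hP t e) (rho_le_rho0 hP ht e))
        (inv_add_le_transGain (hx e).1 (hx e).2) (by positivity)
        (one_div_pos.2 (rho_pos hP t e)).le
    have hg0 : 0 ≤ 1 / P.rho0 e * (1 / (bUp P qs q0 e + bLo P qs q0 e)) := by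
      have b1 := bUp_pos (q0 := q0) hP e
      have b2 := bLo_pos (q0 := q0) hP e
      have b3 := rho0_pos hP e
      positivity
    have h12 := (hκle e).trans (mul_le_mul_of_nonneg_right (pow_le_pow_left₀ hg0 hg 2) hk.le)
    have h13 : z e ^ 2 = gainOf P qs q0 x e ^ 2 * P.k e * (P.k e * transErrOf P qs q0 x e ^ 2) := by
      rw [hz, edgeForce]
      ring
    rw [h13]
    exact mul_le_mul_of_nonneg_right h12 (by positivity)
  have h14 : barrierDeriv P qs q0 t p (feedback P qs q0 x + l)
      = 2 * ∑ e, z e * inner ℝ (edgeVec p e) (edgeVec (feedback P qs q0 x + l) e) -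
        ∑ e, z e * (rhoDeriv P t e * errOf P qs x e) := by
    rw [barrierDeriv, Finset.mul_sum, ← Finset.sum_sub_distrib]
    refine Finset.sum_congr rfl fun e _ => ?_
    ring
  rw [Finset.sum_add_distrib, ← Finset.sum_div, Finset.sum_const, Finset.card_univ,
    Fintype.card_fin, nsmul_eq_mul] at h3
  rw [Finset.sum_add_distrib, ← Finset.mul_sum, Finset.sum_const, Finset.card_univ,
    nsmul_eq_mul] at h6
  rw [div_lt_iff₀ (by positivity)] at hV
  have h15 := mul_le_mul_of_nonneg_left h11 (half_pos hlam).le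
  rw [h14, h2]
  linarith

/-- As `M₀ < M`, the barrier has negative right derivative whenever it equals `M`, so it cannot
cross that level. Right derivatives of `Δ` are all that is needed. -/
theorem isForwardInvariant_sublevel {Δ : ℝ → Config n m} {D M M₀ : ℝ} (hP : P.Admissible qs)
    (hΔ : ∀ t, 0 ≤ t → ∃ l : Config n m, (∀ i, ‖l i‖ ≤ D) ∧ HasDerivWithinAt Δ l (Ici t) t)
    (hdec : ∀ (t : ℝ) (p l : Config n m), 0 ≤ t →
      (t, edgeVecL n m G p) ∈ boundedRegion P qs q0 → (∀ i, ‖l i‖ ≤ D) →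
      M₀ < barrier P qs q0 (t, edgeVecL n m G p) →
      barrierDeriv P qs q0 t p (feedback P qs q0 (t, edgeVecL n m G p) + l) < 0)
    (hM : M₀ < M) :
    IsForwardInvariant (feedback P qs q0) (edgeVecL n m G) Δ (boundedRegion P qs q0)
      (sublevel P qs q0 M) := by
  intro a b q ha hqc hqU hqd hK
  choose l hlD hl using fun t : Ici (0 : ℝ) => hΔ t t.2
  let l' : ℝ → Config n m := fun t => if h : 0 ≤ t then l ⟨t, h⟩ else 0
  have hl' : ∀ t, 0 ≤ t → (∀ i, ‖l' t i‖ ≤ D) ∧ HasDerivWithinAt Δ (l' t) (Ici t) t := by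
    intro t ht
    have : l' t = l ⟨t, ht⟩ := dif_pos ht
    rw [this]
    exact ⟨hlD ⟨t, ht⟩, hl ⟨t, ht⟩⟩
  have hder : ∀ s ∈ Ico a b, HasDerivWithinAt (fun r => barrier P qs q0 (r, edgeVecL n m G (q r)))
      (barrierDeriv P qs q0 s (q s) (feedback P qs q0 (s, edgeVecL n m G (q s)) + l' s))
      (Ici s) s := by
    intro s hs
    refine hasDerivWithinAt_barrier hP ?_ (hqU s (Ico_subset_Icc_self hs))
    have := (hqd s hs).add (hl' s (ha.trans hs.1)).2
    refine this.congr_of_eventuallyEq (Eventually.of_forall fun r => ?_) ?_ <;> simp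
  have hVc : ContinuousOn (fun r => barrier P qs q0 (r, edgeVecL n m G (q r))) (Icc a b) := by
    intro s hs
    exact ContinuousAt.comp_continuousWithinAt (f := fun r => (r, edgeVecL n m G (q r)))
      (contDiffAt_barrier hP (hqU s hs)).continuousAt (continuousOn_graph hqc s hs)
  have hle := image_le_of_deriv_right_lt_deriv_boundary hVc hder (B := fun _ => M)
    (B' := fun _ => 0) hK.2 (fun s => hasDerivAt_const s M) fun s hs hsM =>
      hdec s (q s) (l' s) (ha.trans hs.1) (hqU s (Ico_subset_Icc_self hs))
        (hl' s (ha.trans hs.1)).1 (hM.trans_eq hsM.symm)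
  exact fun s hs => ⟨hqU s hs, hle hs⟩


/-! ### Bounded piecewise continuous disturbances -/

section Disturbance

variable {E : Type*} [NormedAddCommGroup E]

theorem PiecewiseContinuous.intervalIntegrable {δ : ℝ → E}
    (h : PiecewiseContinuous δ) {D : ℝ} (hD : ∀ t, 0 ≤ t → ‖δ t‖ ≤ D) {t : ℝ} (ht : 0 ≤ t) :
    IntervalIntegrable δ volume 0 t := by
  rw [intervalIntegrable_iff_integrableOn_Icc_of_le ht]
  set F := {s ∈ Icc 0 t | ¬ ContinuousWithinAt δ (Ici 0) s} with hF
  have hFfin : F.Finite := h.1 t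
  have hc : ContinuousOn δ (Icc 0 t \ F) := by
    intro s hs
    have : ContinuousWithinAt δ (Ici 0) s := by
      by_contra hcon
      exact hs.2 ⟨hs.1, hcon⟩
    exact this.mono fun r hr => hr.1.1
  have hae : (Icc 0 t \ F : Set ℝ) =ᵐ[volume] Icc 0 t :=
    sdiff_null_ae_eq_self (hFfin.measure_zero volume)
  have hm : AEStronglyMeasurable δ (volume.restrict (Icc 0 t)) := by
    rw [← Measure.restrict_congr_set hae]
    exact hc.aestronglyMeasurable (measurableSet_Icc.diff hFfin.measurableSet)
  exact IntegrableOn.of_bound measure_Icc_lt_top hm D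
    ((ae_restrict_iff' measurableSet_Icc).2 (Eventually.of_forall fun s hs => hD s hs.1))

theorem PiecewiseContinuous.continuousOn_integral [NormedSpace ℝ E] {δ : ℝ → E}
    (h : PiecewiseContinuous δ) {D : ℝ} (hD : ∀ t, 0 ≤ t → ‖δ t‖ ≤ D) :
    ContinuousOn (fun t => ∫ s in (0 : ℝ)..t, δ s) (Ici 0) := by
  intro t ht
  have ht' : (0 : ℝ) ≤ t := ht
  have hint : IntegrableOn δ (uIcc 0 (t + 1)) volume := by
    rw [uIcc_of_le (by linarith), ← intervalIntegrable_iff_integrableOn_Icc_of_le (by linarith)]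
    exact h.intervalIntegrable hD (by linarith)
  have hc := intervalIntegral.continuousOn_primitive_interval hint
  rw [uIcc_of_le (by linarith)] at hc
  refine (hc t ⟨ht', by linarith⟩).mono_of_mem_nhdsWithin ?_
  rw [← Ici_inter_Iic]
  exact inter_mem_nhdsWithin _ (Iic_mem_nhds (by linarith))

/-- The right derivative is the right limit `l`, which may differ from `δ t` at a jump. -/
theorem PiecewiseContinuous.hasDerivWithinAt_integral [NormedSpace ℝ E] [CompleteSpace E]
    {δ : ℝ → E} (h : PiecewiseContinuous δ) {D : ℝ} (hD : ∀ t, 0 ≤ t → ‖δ t‖ ≤ D) {t : ℝ}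
    (ht : 0 ≤ t) {l : E} (hl : Tendsto δ (𝓝[>] t) (𝓝 l)) :
    HasDerivWithinAt (fun t => ∫ s in (0 : ℝ)..t, δ s) l (Ici t) t := by
  have h1 : IntegrableOn δ (Ioc 0 (t + 1)) volume :=
    (intervalIntegrable_iff_integrableOn_Ioc_of_le (by linarith)).1
      (h.intervalIntegrable hD (by linarith))
  refine intervalIntegral.integral_hasDerivWithinAt_of_tendsto_ae_right
    (h.intervalIntegrable hD ht) (t := Ioi t) ⟨Ioc t (t + 1), Ioc_mem_nhdsGT (by linarith), ?_⟩
    (hl.mono_left inf_le_left)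
  exact (h1.mono_set (Ioc_subset_Ioc_left ht)).aestronglyMeasurable

end Disturbance

variable {n m : ℕ} {G : SimpleGraph (Fin n)} [Fintype G.edgeSet] {P : Params G}
  {qs q0 : Config n m} {δ : ℝ → Config n m}

theorem IsSolutionOn.isForcedSolution {I : Set ℝ} {q : ℝ → Config n m} {T : ℝ}
    (hδ : ∀ t, 0 ≤ t → IntervalIntegrable δ volume 0 t) (h : IsSolutionOn P qs q0 δ I q)
    (hT : Icc 0 T ⊆ I) :
    IsForcedSolution (feedback P qs q0) (edgeVecL n m G) (fun t => ∫ s in (0 : ℝ)..t, δ s) q0 T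
      q := by
  refine ⟨h.1.mono hT, fun t ht => ?_⟩
  obtain ⟨h1, h2⟩ := h.2 t (hT ht)
  have h3 := h1.sub (hδ t ht.1)
  simp only [controlLaw_eq_feedback] at h1 h2 h3
  have h4 : IntervalIntegrable (fun s => feedback P qs q0 (s, edgeVecL n m G (q s))) volume 0 t := by
    refine h3.congr fun s _ => ?_
    simp
  refine ⟨h4, ?_⟩
  rw [h2, intervalIntegral.integral_add h4 (hδ t ht.1), add_assoc]

theorem isSolutionOn_of_isForcedSolution {q : ℝ → Config n m}
    (hδ : ∀ t, 0 ≤ t → IntervalIntegrable δ volume 0 t)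
    (h : ∀ T, IsForcedSolution (feedback P qs q0) (edgeVecL n m G)
      (fun t => ∫ s in (0 : ℝ)..t, δ s) q0 T q) :
    IsSolutionOn P qs q0 δ (Ici 0) q := by
  refine ⟨fun t ht => ?_, fun t ht => ?_⟩
  · have ht' : (0 : ℝ) ≤ t := ht
    refine ((h (t + 1)).1 t ⟨ht', by linarith⟩).mono_of_mem_nhdsWithin ?_
    rw [← Ici_inter_Iic]
    exact inter_mem_nhdsWithin _ (Iic_mem_nhds (by linarith))
  · obtain ⟨h1, h2⟩ := (h t).2 t ⟨ht, le_rfl⟩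
    simp only [controlLaw_eq_feedback]
    refine ⟨h1.add (hδ t ht), ?_⟩
    rw [intervalIntegral.integral_add h1 (hδ t ht), ← add_assoc]
    exact h2

end Formation

/-! ### The global solution and its properties -/

open Formation

theorem theorem1 (n m : ℕ) (hm : m = 2 ∨ m = 3)
    (G : SimpleGraph (Fin n)) [Fintype G.edgeSet]
    (qs : Formation.Config n m)
    (hrigid : Formation.MinInfRigid G qs)
    (hamb : Formation.AmbiguitiesInfRigid G qs) :
    ∃ ϑ : ℝ, 0 < ϑ ∧
      ∀ (P : Formation.Params G) (q0 : Formation.Config n m) (δ : ℝ → Formation.Config n m),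
        P.Admissible qs →
        -- initially, neighbours neither collide nor are out of range
        (∀ e : G.edgeSet, P.rsE e < Formation.edgeLen q0 e ∧ Formation.edgeLen q0 e < P.rcE e) →
        Formation.InOmegaI P qs q0 ϑ →
        Formation.PiecewiseContinuous δ →
        (∃ D : ℝ, ∀ t, 0 ≤ t → ∀ i, ‖δ t i‖ ≤ D) →
        ∃ q : ℝ → Formation.Config n m,
          -- the closed loop has a solution on `[0, ∞)`, which extends every local solution
          Formation.IsSolutionOn P qs q0 δ (Ici 0) q ∧
          (∀ (T : ℝ) (q' : ℝ → Formation.Config n m),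
            Formation.IsSolutionOn P qs q0 δ (Ico 0 T) q' → EqOn q' q (Ico 0 T)) ∧
          -- prescribed performance
          (∀ t, 0 ≤ t → ∀ e : G.edgeSet,
            -(Formation.bLo P qs q0 e * Formation.rho P t e) < Formation.sqErr qs (q t) e ∧
            Formation.sqErr qs (q t) e < Formation.bUp P qs q0 e * Formation.rho P t e) ∧
          -- connectivity maintenance and collision avoidance
          (∀ t, 0 ≤ t → ∀ e : G.edgeSet, Formation.edgeLen (q t) e < P.rcE e) ∧
          (∀ t, 0 ≤ t → ∀ e : G.edgeSet, P.rsE e < Formation.edgeLen (q t) e) ∧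
          -- infinitesimal rigidity, in particular at time `0`
          (∀ t, 0 ≤ t → Formation.InfRigid G (q t)) ∧
          -- boundedness of the closed-loop signals
          (∃ C : ℝ, ∀ t, 0 ≤ t →
            (∀ e : G.edgeSet,
              Formation.edgeLen (q t) e ≤ C ∧
              |Formation.distErr qs (q t) e| ≤ C ∧
              |Formation.sqErr qs (q t) e| ≤ C ∧
              |Formation.modErr P qs t (q t) e| ≤ C ∧
              |Formation.sigma P qs q0 t (q t) e| ≤ C ∧
              |Formation.xi P qs q0 t (q t) e| ≤ C) ∧
            ∀ i, ‖Formation.controlLaw P qs q0 t (q t) i‖ ≤ C) := by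
  obtain ⟨ϑ, hϑ, lam, hlam, hrig⟩ := exists_uniform_rigidity hrigid hamb
  refine ⟨ϑ, hϑ, fun P q0 δ hP h0 hΩ hδ ⟨D, hD⟩ => ?_⟩
  have hD' : ∀ t, 0 ≤ t → ‖δ t‖ ≤ max D 0 := fun t ht =>
    (pi_norm_le_iff_of_nonneg (le_max_right _ _)).2 fun i => (hD t ht i).trans (le_max_left _ _)
  have hδi : ∀ t, 0 ≤ t → IntervalIntegrable δ volume 0 t := fun t ht =>
    hδ.intervalIntegrable hD' ht
  obtain ⟨M₀, hdec⟩ := barrierDeriv_neg_of_large (q0 := q0) (D := max D 0) hP hlam hrig hΩ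
  -- Above the initial barrier value, so that the motion starts in the sublevel set, and strictly
  -- above `M₀`, so that this set is invariant.
  set M := max M₀ (barrier P qs q0 (0, edgeVecL n m G q0)) + 1
  have hΔ : ∀ t, 0 ≤ t → ∃ l : Config n m, (∀ i, ‖l i‖ ≤ max D 0) ∧
      HasDerivWithinAt (fun t => ∫ s in (0 : ℝ)..t, δ s) l (Ici t) t := by
    intro t ht
    obtain ⟨l, hl⟩ := hδ.2.1 t ht
    refine ⟨l, fun i => ?_, hδ.hasDerivWithinAt_integral hD' ht hl⟩
    refine (norm_le_pi_norm l i).trans (le_of_tendsto hl.norm ?_)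
    filter_upwards [self_mem_nhdsWithin] with s hs
    exact hD' s (ht.trans (le_of_lt hs))
  have hinv := isForwardInvariant_sublevel (Δ := fun t => ∫ s in (0 : ℝ)..t, δ s) hP hΔ hdec
    (M := M) (by linarith [le_max_left M₀ (barrier P qs q0 (0, edgeVecL n m G q0))])
  have hstart : (0, edgeVecL n m G q0) ∈ sublevel P qs q0 M :=
    ⟨fun e => (prescribedAt_iff hP 0 q0 e).1 (prescribedAt_zero hP (h0 e)), by
      linarith [le_max_right M₀ (barrier P qs q0 (0, edgeVecL n m G q0))]⟩
  have hKU : sublevel P qs q0 M ⊆ boundedRegion P qs q0 := fun x hx => hx.1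
  have hΔc := hδ.continuousOn_integral hD'
  have hΔ0 : (fun t => ∫ s in (0 : ℝ)..t, δ s) 0 = 0 := intervalIntegral.integral_same
  obtain ⟨q, hq, hqK⟩ := exists_isForcedSolution (f := feedback P qs q0) (L := edgeVecL n m G)
    (Δ := fun t => ∫ s in (0 : ℝ)..t, δ s) (q₀ := q0) (isOpen_boundedRegion hP)
    (contDiffOn_feedback hP) hKU (isCompact_sublevel hP M) hΔc hΔ0 hinv hstart
  have hbd : ∀ t, 0 ≤ t → ∀ e, PrescribedAt P qs q0 t (q t) e := fun t ht e =>
    (prescribedAt_iff hP t (q t) e).2 ((hqK t ht).1 e)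
  obtain ⟨C, hC⟩ := exists_signal_bounds (q0 := q0) hP M
  refine ⟨q, isSolutionOn_of_isForcedSolution hδi hq, fun T q' hq' t ht => ?_, hbd,
    fun t ht e => ?_, fun t ht e => ?_, fun t ht => ?_, C, fun t ht => hC t (q t) ht (hqK t ht)⟩
  · have hforced : IsForcedSolution (feedback P qs q0) (edgeVecL n m G)
        (fun t => ∫ s in (0 : ℝ)..t, δ s) q0 t q' :=
      hq'.isForcedSolution hδi fun s hs => ⟨hs.1, hs.2.trans_lt ht.2⟩
    have heq : EqOn q' q (Icc 0 t) :=
      IsForcedSolution.eqOn (f := feedback P qs q0) (L := edgeVecL n m G)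
        (Δ := fun t => ∫ s in (0 : ℝ)..t, δ s) (q₀ := q0) (isOpen_boundedRegion hP)
        (contDiffOn_feedback hP) hKU
        (isCompact_sublevel hP M t) (hΔc.mono Icc_subset_Ici_self) (hq t) hforced
        fun s hs => hqK s hs.1
    exact heq ⟨ht.1, le_rfl⟩
  · have h1 := ((hbd t ht e).distErr_bounds hP ht).2
    have h2 := upErr0_le (q0 := q0) hP e
    unfold distErr at h1
    linarith
  · have h1 := ((hbd t ht e).distErr_bounds hP ht).1
    have h2 := loErr0_le (q0 := q0) hP e
    unfold distErr at h1
    linarith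
  · rw [infRigid_iff hrigid]
    intro z hz
    have h1 := hrig (q t) (sum_abs_distErr_le hP ht hΩ (hbd t ht)) z
    rw [(sum_norm_sq_eq_zero_iff _).2 hz] at h1
    have h2 : 0 ≤ ∑ e, z e ^ 2 := Finset.sum_nonneg fun _ _ => sq_nonneg _
    exact (sum_sq_eq_zero_iff z).1 (le_antisymm (nonpos_of_mul_nonpos_right h1 hlam) h2)
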